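/- **Conventions.** $\|\cdot\|_F$, $\|\cdot\|_2$ are the Frobenius and operator norms. For a symmetric matrix $M\in\mathbb R^{d_x\times d_x}$ with eigenvalues $\lambda_1\ge\dots\ge\lambda_{d_x}$ and a corresponding orthonormal eigenbasis, $\underline\lambda_k(M)$ and $\overline\lambda_k(M)$ are the arithmetic means of the $k$ smallest and of the $k$ largest eigenvalues, and $W_{-k}$ is the matrix of the last $k$ eigenvectors. For $A\in\mathbb R^{d_y\times d_x}$ with a fixed singular value decomposition, $U_k$ is the matrix of the first $k$ left singular vectors and $\Pi_k(A)$ the truncation of $A$ to its $k$ largest singular values. *Packings.* For $C>1$, a $C$-packing family consists of finite sets $\mathcal P_k^d\subset\{Q\in\mathbb R^{d\times k}:Q^\top Q=I_k\}$, $1\le k\le d/2$, with $|\mathcal P_k^d|\ge 2^{kd}$ and $\|Q-Q'\|_F>\sqrt k/C$ for distinct $Q,Q'\in\mathcal P_k^d$. *Models.* The noise is $\eta\sim\mathcal N(0,\sigma^2I)$, $\sigma>0$. (i) Multivariate regression: $n$ i.i.d. pairs $(x_i,y_i)$, $y_i=Ax_i+\eta_i$, with $x_i$ independent of $\eta_i$,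 of a square-integrable law that does not depend on $A$, with $M:=\mathbb E[x_ix_i^\top]\succ0$. (ii) Linear system identification: $d_x=d_y=d$, $x_0=0$, $x_{t+1}=Ax_t+\eta_t$ with i.i.d. $\eta_t$, observed pairs $(x_t,x_{t+1})$, $0\le t<n$; here the spectral radius of the true matrix satisfies $\rho(A)<1$, $\Gamma_\infty(A)=\sum_{t\ge0}A^t(A^t)^\top$, and $M:=\sigma^2\Gamma_\infty(A)$ is the stationary covariance. *Effective rank.* Let $\varepsilon>0$, $0<\delta\le\frac12$, $r\ge1$ and $\operatorname{rank}(A)\le r\le\frac12\min(d_x,d_y)$. For $n\ge1$ put $$T_n(k)=\sigma^2\max\Big\{\frac{k\,d_y+\log(1/\delta)}{n\,\underline\lambda_k(M)},\ \frac{k\,d_x+\log(1/\delta)}{n\,\overline\lambda_k(M)}\Big\}+\|A-\Pi_k(A)\|_F^2 .$$ Let $k^\star_n$ be the optimal effective rank, i.e. the smallest minimiser of $T_n$ over $\{1,\dots,r\}$, or, more generally, any rule $n\mapsto k^\star_n\in\{1,\dots,r\}$; put $\gamma_A^\delta(n)=T_n(k^\star_n)$. *Stability.* Let $\mathcal D(A,n,\varepsilon)$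 be the set of all $A+\frac{2C\varepsilon}{\sqrt k}QW_{-k}^\top$, $Q\in\mathcal P_k^{d_y}$, and all $A+\frac{2C\varepsilon}{\sqrt k}U_kR^\top$, $R\in\mathcal P_k^{d_x}$, where $k=k^\star_n$. An algorithm (measurable estimators $\hat A_n$ computed from $n$ observations, $n\ge1$) is $(\varepsilon,\delta)$-stable at $A$ if for some $n\ge1$ $$\|A-\Pi_{k^\star_n}(A)\|_F\le\varepsilon\quad\text{and}\quad \mathbb P_{A'}\big(\|\hat A_n-A'\|_F\le\varepsilon\big)\ge1-\delta\ \text{ for all }A'\in\{A\}\cup\mathcal D(A,n,\varepsilon),$$ and its sample complexity $N$ is the least such $n$. **Theorem.** There are $C>1$ and a $C$-packing family. Moreover, for every $C>1$ and every $C$-packing family, any $(\varepsilon,\delta)$-stable algorithm at $A$ has sample complexity $$N\ \ge\ \min\Big\{n\ge1:\ \gamma_A^\delta(n)\le\frac{32\,C^2}{\log2}\,\varepsilon^2\Big\},$$ this set being nonempty, in multivariate regression (i), and also in linear system identification (ii) provided that $\dfrac{2C\varepsilon}{\sqrt{k^\star_N}}\le\dfrac{1}{4\|\Gamma_\infty(A)\|_2^{3}}$.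 -/

import Mathlib

open MeasureTheory ProbabilityTheory Matrix

noncomputable section

namespace RankAdaptive

/-! ## Norms, spectral and singular value decompositions -/

/-- Frobenius norm. -/
def frob {p q : ℕ} (M : Matrix (Fin p) (Fin q) ℝ) : ℝ :=
  √(∑ i, ∑ j, M i j ^ 2)

/-- Operator norm of a matrix with respect to the Euclidean norms. -/
def opNorm {d : ℕ} (M : Matrix (Fin d) (Fin d) ℝ) : ℝ :=
  ‖Matrix.toEuclideanCLM (n := Fin d) (𝕜 := ℝ) M‖

/-- An orthogonal diagonalisation of `M` with the eigenvalues listed in nonincreasing order. -/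
structure EigenDecomp {d : ℕ} (M : Matrix (Fin d) (Fin d) ℝ) where
  /-- the columns are the eigenvectors -/
  vec : Matrix (Fin d) (Fin d) ℝ
  /-- the eigenvalues -/
  val : Fin d → ℝ
  orth : vecᵀ * vec = 1
  anti : Antitone val
  eq : M = vec * Matrix.diagonal val * vecᵀ

/-- The `p × q` matrix with `s 0, s 1, …` on the main diagonal and zeros elsewhere. -/
def rectDiag (p q : ℕ) (s : ℕ → ℝ) : Matrix (Fin p) (Fin q) ℝ :=
  Matrix.of fun i j => if i.val = j.val then s i.val else 0

/-- A full singular value decomposition `A = U S Vᵀ`, with the singular values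
`sv 0 ≥ sv 1 ≥ … ≥ 0` on the diagonal of the rectangular matrix `S`. -/
structure SVD {p q : ℕ} (A : Matrix (Fin p) (Fin q) ℝ) where
  /-- left singular vectors (columns) -/
  U : Matrix (Fin p) (Fin p) ℝ
  /-- right singular vectors (columns) -/
  V : Matrix (Fin q) (Fin q) ℝ
  /-- singular values -/
  sv : ℕ → ℝ
  orthU : Uᵀ * U = 1
  orthV : Vᵀ * V = 1
  nonneg : ∀ i, 0 ≤ sv i
  anti : Antitone sv
  eq : A = U * rectDiag p q sv * Vᵀ

/-- `Π_k(A)`: only the `k` largest singular values are kept. -/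
def SVD.trunc {p q : ℕ} {A : Matrix (Fin p) (Fin q) ℝ} (S : SVD A) (k : ℕ) :
    Matrix (Fin p) (Fin q) ℝ :=
  S.U * rectDiag p q (fun i => if i < k then S.sv i else 0) * S.Vᵀ

/-- The first `k` columns (used for `k ≤ d`). -/
def firstCols {d : ℕ} (M : Matrix (Fin d) (Fin d) ℝ) (k : ℕ) : Matrix (Fin d) (Fin k) ℝ :=
  Matrix.of fun i j => if h : j.val < d then M i ⟨j.val, h⟩ else 0

/-- The last `k` columns (used for `k ≤ d`). -/
def lastCols {d : ℕ} (M : Matrix (Fin d) (Fin d) ℝ) (k : ℕ) : Matrix (Fin d) (Fin k) ℝ :=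
  Matrix.of fun i j => if h : d - k + j.val < d then M i ⟨d - k + j.val, h⟩ else 0

/-- Arithmetic mean of the `k` smallest eigenvalues. -/
def EigenDecomp.lowMean {d : ℕ} {M : Matrix (Fin d) (Fin d) ℝ} (E : EigenDecomp M) (k : ℕ) : ℝ :=
  (∑ i : Fin d with d - k ≤ i.val, E.val i) / k

/-- Arithmetic mean of the `k` largest eigenvalues. -/
def EigenDecomp.highMean {d : ℕ} {M : Matrix (Fin d) (Fin d) ℝ} (E : EigenDecomp M) (k : ℕ) : ℝ :=
  (∑ i : Fin d with i.val < k, E.val i) / k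

/-! ## Packings of Stiefel manifolds and confusing models -/

/-- `P k d` is, for all `1 ≤ k ≤ d / 2`, a set of at least `2 ^ (k d)` matrices with orthonormal
columns in `ℝ^{d × k}`, any two of them more than `√k / C` apart in Frobenius norm. -/
def IsStiefelPacking (C : ℝ) (P : (k d : ℕ) → Finset (Matrix (Fin d) (Fin k) ℝ)) : Prop :=
  ∀ k d : ℕ, 1 ≤ k → 2 * k ≤ d →
    (∀ Q ∈ P k d, Qᵀ * Q = 1) ∧
    2 ^ (k * d) ≤ (P k d).card ∧
    ∀ Q ∈ P k d, ∀ Q' ∈ P k d, Q ≠ Q' → √(k : ℝ) / C < frob (Q - Q')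

/-- The confusing models at rank `k`: `A + (2 C ε / √k) Q W_{-k}ᵀ` with `Q ∈ P k dy`, where
`W_{-k}` holds the eigenvectors of the `k` smallest eigenvalues of the covariance `M`, and
`A + (2 C ε / √k) U_k Rᵀ` with `R ∈ P k dx`, where `U_k` holds the top `k` left singular vectors
of `A`. -/
def confusing {dx dy : ℕ} (C : ℝ) (P : (k d : ℕ) → Finset (Matrix (Fin d) (Fin k) ℝ))
    {A : Matrix (Fin dy) (Fin dx) ℝ} (S : SVD A)
    {M : Matrix (Fin dx) (Fin dx) ℝ} (E : EigenDecomp M) (k : ℕ) (ε : ℝ) :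
    Set (Matrix (Fin dy) (Fin dx) ℝ) :=
  {A' | ∃ Q ∈ P k dy, A' = A + (2 * C * ε / √(k : ℝ)) • (Q * (lastCols E.vec k)ᵀ)} ∪
  {A' | ∃ R ∈ P k dx, A' = A + (2 * C * ε / √(k : ℝ)) • (firstCols S.U k * Rᵀ)}

/-! ## Observation models and algorithms -/

/-- `n` observations `(x_i, y_i)`. -/
abbrev Sample (dx dy n : ℕ) : Type := Fin n → (Fin dx → ℝ) × (Fin dy → ℝ)

/-- The Gaussian law `N(0, σ² I_d)`. -/
def noise (d : ℕ) (σ : ℝ) : Measure (Fin d → ℝ) :=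
  Measure.pi fun _ => gaussianReal 0 (Real.toNNReal (σ ^ 2))

/-- Multivariate regression: `n` i.i.d. pairs `(x, A x + η)`, with `x ∼ ν` and
`η ∼ N(0, σ² I)` independent. -/
def regressionLaw {dx dy : ℕ} (ν : Measure (Fin dx → ℝ)) (σ : ℝ) (n : ℕ)
    (A : Matrix (Fin dy) (Fin dx) ℝ) : Measure (Sample dx dy n) :=
  Measure.pi fun _ => (ν.prod (noise dy σ)).map fun p => (p.1, A *ᵥ p.1 + p.2)

/-- The states `x_0 = 0`, `x_{t+1} = A x_t + η_t`. -/
def state {d n : ℕ} (A : Matrix (Fin d) (Fin d) ℝ) (η : Fin n → Fin d → ℝ) : ℕ → Fin d → ℝ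
  | 0 => 0
  | t + 1 => A *ᵥ state A η t + (if h : t < n then η ⟨t, h⟩ else 0)

/-- System identification: the `n` observations `(x_t, x_{t+1})`, `0 ≤ t < n`, along one trajectory
driven by i.i.d. noise `η_t ∼ N(0, σ² I)`. -/
def sysIdLaw {d : ℕ} (σ : ℝ) (n : ℕ) (A : Matrix (Fin d) (Fin d) ℝ) : Measure (Sample d d n) :=
  (Measure.pi fun _ : Fin n => noise d σ).map
    fun η i => (state A η i.val, state A η (i.val + 1))

/-- The matrix `E[x xᵀ]` of second moments. -/
def secondMoment {d : ℕ} (ν : Measure (Fin d → ℝ)) : Matrix (Fin d) (Fin d) ℝ :=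
  Matrix.of fun i j => ∫ x, x i * x j ∂ν

/-- `Γ_∞(A) = ∑_{t ≥ 0} A^t (A^t)ᵀ`. -/
def gramian {d : ℕ} (A : Matrix (Fin d) (Fin d) ℝ) : Matrix (Fin d) (Fin d) ℝ :=
  ∑' t : ℕ, A ^ t * (A ^ t)ᵀ

/-- An algorithm: for each `n`, an estimator computed from `n` observations. -/
abbrev Algorithm (dx dy : ℕ) : Type := (n : ℕ) → Sample dx dy n → Matrix (Fin dy) (Fin dx) ℝ

/-- The requirements of `(ε, δ)`-stability at `A` with `n` observations, for the observation model
`law` and the effective rank `κ n`: the rank-`κ n` approximation of `A` has error at most `ε`, and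
under `A` and each confusing model at rank `κ n` the estimator has error at most `ε` with
probability at least `1 - δ`. -/
def StableWith {dx dy : ℕ} (C : ℝ) (P : (k d : ℕ) → Finset (Matrix (Fin d) (Fin k) ℝ))
    (law : (n : ℕ) → Matrix (Fin dy) (Fin dx) ℝ → Measure (Sample dx dy n))
    {A : Matrix (Fin dy) (Fin dx) ℝ} (S : SVD A)
    {M : Matrix (Fin dx) (Fin dx) ℝ} (E : EigenDecomp M)
    (κ : ℕ → ℕ) (ε δ : ℝ) (alg : Algorithm dx dy) (n : ℕ) : Prop :=
  frob (A - S.trunc (κ n)) ≤ ε ∧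
  ∀ A' ∈ {A} ∪ confusing C P S E (κ n) ε,
    1 - δ ≤ (law n A').real {z | frob (alg n z - A') ≤ ε}

/-- `(ε, δ)`-stability at `A`. -/
def IsStableAlg {dx dy : ℕ} (C : ℝ) (P : (k d : ℕ) → Finset (Matrix (Fin d) (Fin k) ℝ))
    (law : (n : ℕ) → Matrix (Fin dy) (Fin dx) ℝ → Measure (Sample dx dy n))
    {A : Matrix (Fin dy) (Fin dx) ℝ} (S : SVD A)
    {M : Matrix (Fin dx) (Fin dx) ℝ} (E : EigenDecomp M)
    (κ : ℕ → ℕ) (ε δ : ℝ) (alg : Algorithm dx dy) : Prop :=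
  ∃ n, 1 ≤ n ∧ StableWith C P law S E κ ε δ alg n

/-- The sample complexity of a stable algorithm: the least number of observations with which the
stability requirements hold. -/
def sampleComplexity {dx dy : ℕ} (C : ℝ) (P : (k d : ℕ) → Finset (Matrix (Fin d) (Fin k) ℝ))
    (law : (n : ℕ) → Matrix (Fin dy) (Fin dx) ℝ → Measure (Sample dx dy n))
    {A : Matrix (Fin dy) (Fin dx) ℝ} (S : SVD A)
    {M : Matrix (Fin dx) (Fin dx) ℝ} (E : EigenDecomp M)
    (κ : ℕ → ℕ) (ε δ : ℝ) (alg : Algorithm dx dy) : ℕ :=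
  sInf {n | 1 ≤ n ∧ StableWith C P law S E κ ε δ alg n}

/-! ## The trade-off -/

/-- Estimation cost at rank `k` plus squared approximation error at rank `k`
(for `n ≥ 1` observations with covariance `M`). -/
def tradeoff {dx dy : ℕ} {A : Matrix (Fin dy) (Fin dx) ℝ} (S : SVD A)
    {M : Matrix (Fin dx) (Fin dx) ℝ} (E : EigenDecomp M) (σ δ : ℝ) (n k : ℕ) : ℝ :=
  σ ^ 2 * max ((k * dy + Real.log (1 / δ)) / (n * E.lowMean k))
      ((k * dx + Real.log (1 / δ)) / (n * E.highMean k))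
    + frob (A - S.trunc k) ^ 2

/-- The optimal effective rank: the (smallest) minimiser of the trade-off over `1 ≤ k ≤ r`. -/
def optimalRank {dx dy : ℕ} {A : Matrix (Fin dy) (Fin dx) ℝ} (S : SVD A)
    {M : Matrix (Fin dx) (Fin dx) ℝ} (E : EigenDecomp M) (σ δ : ℝ) (r n : ℕ) : ℕ :=
  sInf {k | k ∈ Set.Icc 1 r ∧ ∀ j ∈ Set.Icc 1 r, tradeoff S E σ δ n k ≤ tradeoff S E σ δ n j}

/-- `γ_A^δ(n)`, the trade-off at the effective rank `κ n`. -/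
def gammaFn {dx dy : ℕ} {A : Matrix (Fin dy) (Fin dx) ℝ} (S : SVD A)
    {M : Matrix (Fin dx) (Fin dx) ℝ} (E : EigenDecomp M) (σ δ : ℝ) (κ : ℕ → ℕ) (n : ℕ) : ℝ :=
  tradeoff S E σ δ n (κ n)

end RankAdaptive

end

open RankAdaptive

/-! The bound is a Fano argument made twice at the effective rank `k`. Put `s = 2Cε/√k`. Perturbing
`A` by `s Q W_{-k}ᵀ` or by `s U_k Rᵀ`, with `Q` or `R` in a packing, gives at least `2^(k d_y)` or
`2^(k d_x)` models that are more than `2ε` apart and more than `2ε` from `A`. The events "the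
estimate is `ε`-close to the model" are then disjoint. Since the estimator succeeds at `A` with
probability at least `1 - δ`, one of them has probability at most `δ 2^(-k d)` under `A`, yet at
least `1 - δ` under its own model. A Donsker–Varadhan inequality turns this contrast into `k d +
log(1/δ) ≤ 8 K`, where `K` bounds the information between the two laws (`add_log_le_of_packing`).

For Gaussian noise this information is governed by the second moments of the covariates along the
perturbation, `n s² tr(Yᵀ M Y)/σ²` (`InfoBound`). With `Y = W_{-k}` the trace is `k` times the mean
of the `k` smallest eigenvalues; with `Y = R` Ky Fan's principle bounds it by `k` times the mean of
the `k` largest. Each family thus controls one term of the maximum in the trade-off, and stability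
bounds the approximation error by `ε` (`tradeoff_le_of_stableWith`). So the sample complexity itself
belongs to the set whose minimum is claimed to lie below it.

In regression the law of the covariates is unaffected by the perturbation, and the information is
computed exactly (`infoBound_regressionLaw`). In system identification the states follow the
perturbed matrix. There the likelihood ratio comes from a discrete Girsanov formula, and the
smallness of `s` makes `2 Γ_∞(A)` a Lyapunov function for the perturbed system, hence a bound for
its covariances (`gramian_perturbation`, `infoBound_sysIdLaw`).

Packings are built column by column: each new column is taken from a code on the unit sphere
orthogonal to the previous columns, and a Gilbert–Varshamov argument on the resulting tree keeps
paths that differ in at least half of their columns. -/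

noncomputable section

namespace RankAdaptive

/-! ## Separated families of paths in a tree -/

/-- The sequences of length `k` each of whose terms is chosen from a finite set depending on the
list of previous terms. -/
def treePaths {X : Type*} [DecidableEq X] : (k : ℕ) → (List X → Finset X) → Finset (Fin k → X)
  | 0, _ => Finset.univ
  | k + 1, c => (c []).biUnion fun x => (treePaths k fun l => c (x :: l)).image (Fin.cons x)

theorem mem_of_mem_treePaths {X : Type*} [DecidableEq X] {k : ℕ} {c : List X → Finset X}
    {f : Fin k → X} (hf : f ∈ treePaths k c) (j : Fin k) :
    f j ∈ c ((List.ofFn f).take j) := by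
  induction k generalizing c with
  | zero => exact j.elim0
  | succ k ih =>
    simp only [treePaths, Finset.mem_biUnion, Finset.mem_image] at hf
    obtain ⟨x, hx, g, hg, rfl⟩ := hf
    cases j using Fin.cases with
    | zero => simpa using hx
    | succ j => simpa [List.ofFn_succ] using ih hg j

theorem sum_treePaths_succ {X : Type*} [DecidableEq X] (k : ℕ) (c : List X → Finset X)
    (F : (Fin (k + 1) → X) → ℕ) :
    ∑ f ∈ treePaths (k + 1) c, F f =
      ∑ x ∈ c [], ∑ f ∈ treePaths k (fun l => c (x :: l)), F (Fin.cons x f) := by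
  rw [treePaths, Finset.sum_biUnion]
  · refine Finset.sum_congr rfl fun x _ => ?_
    rw [Finset.sum_image]
    intro f _ g _ h
    exact Fin.cons_right_injective (α := fun _ => X) x h
  · intro x _ y _ hxy
    refine Finset.disjoint_left.2 fun f hf hg => hxy ?_
    simp only [Finset.mem_image] at hf hg
    obtain ⟨u, _, rfl⟩ := hf
    obtain ⟨v, _, h⟩ := hg
    simpa using (congrFun h 0).symm

theorem card_treePaths {X : Type*} [DecidableEq X] (a k : ℕ) (c : List X → Finset X)
    (hc : ∀ l, l.length < k → (c l).card = a) : (treePaths k c).card = a ^ k := by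
  induction k generalizing c with
  | zero => simp [treePaths]
  | succ k ih =>
    rw [Finset.card_eq_sum_ones, sum_treePaths_succ]
    simp only [← Finset.card_eq_sum_ones]
    rw [Finset.sum_congr rfl fun x _ => ih (fun l => c (x :: l)) fun l hl => hc _ (by simpa using hl)]
    simp [hc [] (by simp), pow_succ']

/-- Weighting each near coordinate by `a`, the paths have total weight at most `(2 a) ^ k`. -/
theorem sum_weight_treePaths_le {X : Type*} [DecidableEq X] [PseudoMetricSpace X] (a : ℕ)
    (s : ℝ) (k : ℕ) (c : List X → Finset X)
    (hc : ∀ l, l.length < k → (c l).card = a)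
    (hs : ∀ l, ∀ x ∈ c l, ∀ y ∈ c l, x ≠ y → s ≤ dist x y) (g : Fin k → X) :
    ∑ f ∈ treePaths k c, ∏ j, (if dist (f j) (g j) < s / 2 then a else 1) ≤ (2 * a) ^ k := by
  induction k generalizing c with
  | zero => simp [treePaths]
  | succ k ih =>
    rw [sum_treePaths_succ]
    simp only [Fin.prod_univ_succ, Fin.cons_zero, Fin.cons_succ, ← Finset.mul_sum]
    calc _ ≤ ∑ x ∈ c [], (if dist x (g 0) < s / 2 then a else 1) * (2 * a) ^ k := by
          refine Finset.sum_le_sum fun x _ => Nat.mul_le_mul_left _ ?_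
          exact ih (fun l => c (x :: l)) (fun l hl => hc _ (by simpa using hl))
            (fun l => hs (x :: l)) (fun j => g j.succ)
      _ = (∑ x ∈ c [], (if dist x (g 0) < s / 2 then a else 1)) * (2 * a) ^ k := by
          rw [Finset.sum_mul]
      _ ≤ (2 * a) * (2 * a) ^ k := by
          refine Nat.mul_le_mul_right _ ?_
          have hone : ((c []).filter fun x => dist x (g 0) < s / 2).card ≤ 1 := by
            refine Finset.card_le_one.2 fun x hx y hy => ?_
            rw [Finset.mem_filter] at hx hy
            by_contra hxy
            have := hs [] x hx.1 y hy.1 hxy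
            have := dist_triangle_right x y (g 0)
            linarith [hx.2, hy.2]
          have hcard : ((c []).filter fun x => ¬ dist x (g 0) < s / 2).card ≤ a :=
            (Finset.card_filter_le _ _).trans_eq (hc [] (by simp))
          rw [Finset.sum_ite]
          simp only [Finset.sum_const, smul_eq_mul, mul_one]
          nlinarith
      _ = (2 * a) ^ (k + 1) := by ring

/-- In a maximal separated subset every point of `S` is related to some chosen point, so the
neighbourhoods of the chosen points cover `S`. -/
theorem exists_separated_subset {Y : Type*} [DecidableEq Y] (S : Finset Y) (R : Y → Y → Prop)
    (hR : ∀ x y, R x y → R y x)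
    (hself : ∀ x, R x x) (N : ℕ)
    (hN : ∀ y ∈ S, ∀ U ⊆ S, (∀ x ∈ U, R x y) → U.card ≤ N) :
    ∃ T ⊆ S, (∀ x ∈ T, ∀ y ∈ T, x ≠ y → ¬ R x y) ∧ S.card ≤ T.card * N := by
  classical
  obtain ⟨T, hT⟩ := (S.powerset.filter fun T => ∀ x ∈ T, ∀ y ∈ T, x ≠ y → ¬ R x y).exists_maximal
    ⟨∅, by simp⟩
  have hTm := hT.prop
  simp only [Finset.mem_filter, Finset.mem_powerset] at hTm
  refine ⟨T, hTm.1, hTm.2, ?_⟩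
  have hcov : S ⊆ T.biUnion fun y => S.filter fun x => R x y := by
    intro x hx
    by_contra hmem
    have hcon : ∀ y ∈ T, ¬ R x y := fun y hy h =>
      hmem (Finset.mem_biUnion.2 ⟨y, hy, Finset.mem_filter.2 ⟨hx, h⟩⟩)
    have hxT : x ∉ T := fun h => hcon x h (hself x)
    have : insert x T ⊆ T := by
      refine hT.le_of_ge (y := insert x T) ?_ (Finset.subset_insert _ _)
      simp only [Finset.mem_filter, Finset.mem_powerset]
      refine ⟨Finset.insert_subset hx hTm.1, ?_⟩
      intro u hu v hv huv
      rcases Finset.mem_insert.1 hu with rfl | hu' <;> rcases Finset.mem_insert.1 hv with rfl | hv'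
      · exact absurd rfl huv
      · exact hcon v hv'
      · exact fun h => hcon u hu' (hR _ _ h)
      · exact hTm.2 u hu' v hv' huv
    exact hxT (this (Finset.mem_insert_self _ _))
  calc S.card ≤ _ := Finset.card_le_card hcov
    _ ≤ T.card * N := Finset.card_biUnion_le_card_mul _ _ _ fun y hy =>
        hN y (hTm.1 hy) _ (Finset.filter_subset _ _) (by simp)

/-- Gilbert–Varshamov on a tree with `b²` children per node: there are `b^(2k)` paths, and at most
`(2b)^k` of them differ substantially from a given one in fewer than half of the coordinates. A
maximal separated family therefore has at least `(b/2)^k` members. -/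
theorem exists_separated_treePaths {X : Type*} [DecidableEq X] [PseudoMetricSpace X] (b : ℕ)
    (hb : 1 ≤ b) (s : ℝ) (hs0 : 0 < s) (k : ℕ) (hk : 1 ≤ k) (c : List X → Finset X)
    (hc : ∀ l, l.length < k → (c l).card = b ^ 2)
    (hs : ∀ l, ∀ x ∈ c l, ∀ y ∈ c l, x ≠ y → s ≤ dist x y) :
    ∃ T : Finset (Fin k → X), (∀ f ∈ T, ∀ j : Fin k, f j ∈ c ((List.ofFn f).take j)) ∧
      b ^ k ≤ T.card * 2 ^ k ∧
      ∀ f ∈ T, ∀ g ∈ T, f ≠ g → k * (s / 2) ^ 2 ≤ 2 * ∑ j, dist (f j) (g j) ^ 2 := by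
  classical
  let far (f g : Fin k → X) : ℕ := (Finset.univ.filter fun j => s / 2 ≤ dist (f j) (g j)).card
  have hball : ∀ g ∈ treePaths k c, ∀ U ⊆ treePaths k c, (∀ f ∈ U, 2 * far f g < k) →
      U.card ≤ (2 * b) ^ k := by
    intro g hg U hU hUg
    have h1 : U.card * b ^ k ≤ (2 * b) ^ k * b ^ k := by
      calc U.card * b ^ k = ∑ f ∈ U, b ^ k := by simp
        _ ≤ ∑ f ∈ U, ∏ j, (if dist (f j) (g j) < s / 2 then b ^ 2 else 1) := by
          refine Finset.sum_le_sum fun f hf => ?_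
          rw [Finset.prod_ite]
          simp only [Finset.prod_const, one_pow, mul_one, ← pow_mul]
          -- Fewer than `k / 2` far coordinates leave at least `k / 2` near ones, each of weight
          -- `b²`.
          refine Nat.pow_le_pow_right hb ?_
          have h1 := hUg f hf
          have h2 := Finset.card_filter_add_card_filter_not (s := (Finset.univ : Finset (Fin k)))
            fun j => s / 2 ≤ dist (f j) (g j)
          simp only [not_le, Finset.card_univ, Fintype.card_fin] at h2
          simp only [far] at h1
          omega
        _ ≤ ∑ f ∈ treePaths k c, ∏ j, (if dist (f j) (g j) < s / 2 then b ^ 2 else 1) :=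
          Finset.sum_le_sum_of_subset hU
        _ ≤ (2 * b ^ 2) ^ k := sum_weight_treePaths_le (b ^ 2) s k c hc hs g
        _ = _ := by rw [← mul_pow]; ring
    exact Nat.le_of_mul_le_mul_right h1 (by positivity)
  obtain ⟨T, hTS, hT, hcard⟩ := exists_separated_subset (treePaths k c)
    (fun f g => 2 * far f g < k) (fun f g h => by simpa only [far, dist_comm] using h)
    (fun f => by simpa [far, not_le.2 (half_pos hs0)] using Nat.pos_of_ne_zero (by omega)) ((2 * b) ^ k) hball
  refine ⟨T, fun f hf => mem_of_mem_treePaths (hTS hf), ?_, ?_⟩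
  · rw [card_treePaths (b ^ 2) k c hc] at hcard
    have : b ^ k * b ^ k ≤ (T.card * 2 ^ k) * b ^ k := by
      calc b ^ k * b ^ k = (b ^ 2) ^ k := by rw [← pow_mul, two_mul, pow_add]
        _ ≤ _ := hcard
        _ = _ := by rw [mul_pow]; ring
    exact Nat.le_of_mul_le_mul_right this (by positivity)
  · intro f hf g hg hfg
    have h := hT f hf g hg hfg
    simp only [not_lt] at h
    have h1 : (far f g : ℝ) * (s / 2) ^ 2 ≤ ∑ j, dist (f j) (g j) ^ 2 := by
      calc (far f g : ℝ) * (s / 2) ^ 2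
          = ∑ j ∈ Finset.univ.filter fun j => s / 2 ≤ dist (f j) (g j), (s / 2) ^ 2 := by simp [far]
        _ ≤ ∑ j ∈ Finset.univ.filter fun j => s / 2 ≤ dist (f j) (g j), dist (f j) (g j) ^ 2 :=
          Finset.sum_le_sum fun j hj => by
            have := (Finset.mem_filter.1 hj).2
            gcongr
        _ ≤ _ := Finset.sum_le_sum_of_subset_of_nonneg (Finset.filter_subset _ _)
            fun _ _ _ => by positivity
    have h2 : (k : ℝ) ≤ 2 * far f g := by exact_mod_cast h
    nlinarith [sq_nonneg (s / 2)]

/-! ## Packings of spheres and of Stiefel manifolds -/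

/-- The tree with the same `128² = 16384` integers at every node, with separation `1`; `64 = 128 /
2`. -/
theorem exists_grid_code (m : ℕ) (hm : 1 ≤ m) :
    ∃ T : Finset (Fin m → ℝ), 64 ^ m ≤ T.card ∧ (∀ f ∈ T, ∀ j, 0 ≤ f j ∧ f j ≤ 16384) ∧
      ∀ f ∈ T, ∀ g ∈ T, f ≠ g → (m : ℝ) / 8 ≤ ∑ j, (f j - g j) ^ 2 := by
  obtain ⟨T, h1, h2, h3⟩ := exists_separated_treePaths (X := ℝ) 128 (by norm_num) 1 one_pos m hm
    (fun _ => (Finset.range 16384).image fun i : ℕ => (i : ℝ))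
    (fun _ _ => by rw [Finset.card_image_of_injective _ Nat.cast_injective, Finset.card_range]; norm_num)
    (fun _ x hx y hy hxy => by
      simp only [Finset.mem_image] at hx hy
      obtain ⟨i, _, rfl⟩ := hx
      obtain ⟨j, _, rfl⟩ := hy
      rw [Real.dist_eq]
      have : (i : ℤ) - j ≠ 0 := by
        intro h
        exact hxy (by exact_mod_cast congrArg (Int.cast (R := ℝ)) (sub_eq_zero.1 h))
      exact_mod_cast Int.one_le_abs this)
  refine ⟨T, ?_, ?_, ?_⟩
  · have : 64 ^ m * 2 ^ m ≤ T.card * 2 ^ m := by rw [← mul_pow]; exact h2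
    exact Nat.le_of_mul_le_mul_right this (by positivity)
  · intro f hf j
    have := h1 f hf j
    simp only [Finset.mem_image, Finset.mem_range] at this
    obtain ⟨i, hi, h⟩ := this
    rw [← h]
    exact ⟨by positivity, by exact_mod_cast hi.le⟩
  · intro f hf g hg hfg
    have := h3 f hf g hg hfg
    simp only [Real.dist_eq, sq_abs] at this
    linarith

/-- A code of exponential size on the unit sphere of a subspace of dimension above `m`. -/
theorem exists_sphere_code {V : Type*} [NormedAddCommGroup V] [InnerProductSpace ℝ V]
    [FiniteDimensional ℝ V] (W : Submodule ℝ V) (m a : ℕ) (hm : 1 ≤ m)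
    (hW : m + 1 ≤ Module.finrank ℝ W) (ha : a ≤ 64 ^ m) :
    ∃ T : Finset V, T.card = a ∧ (∀ x ∈ T, x ∈ W ∧ ‖x‖ = 1) ∧
      ∀ x ∈ T, ∀ y ∈ T, x ≠ y → (1 / 65536 : ℝ) ≤ dist x y := by
  classical
  obtain ⟨T, hT1, hT2, hT3⟩ := exists_grid_code m hm
  have hm0 : (0 : ℝ) < m := by exact_mod_cast hm
  let e : Fin (m + 1) → V := fun i => (stdOrthonormalBasis ℝ W (Fin.castLE hW i) : V)
  have he : Orthonormal ℝ e :=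
    ((stdOrthonormalBasis ℝ W).orthonormal.comp _ (Fin.castLE_injective hW)).comp_linearIsometry
      W.subtypeₗᵢ
  -- Dividing by `16384 √m` puts the code in the unit ball of `ℝ^m`; the extra coordinate lifts it
  -- to the sphere and can only increase distances. The squared separation is at least `(m/8) /
  -- (16384² m) = 2⁻³¹`, which exceeds `(1/65536)² = 2⁻³²`.
  let w : (Fin m → ℝ) → Fin (m + 1) → ℝ := fun f =>
    Fin.snoc (α := fun _ => ℝ) (fun j => f j / (16384 * √m)) (√(1 - ∑ j, (f j / (16384 * √m)) ^ 2))
  let φ : (Fin m → ℝ) → V := fun f => ∑ i, w f i • e i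
  have hnorm : ∀ u : Fin (m + 1) → ℝ, ‖∑ i, u i • e i‖ ^ 2 = ∑ i, u i ^ 2 := by
    intro u
    rw [← real_inner_self_eq_norm_sq, he.inner_sum]
    simp [sq]
  have hdist : ∀ f ∈ T, ∀ g ∈ T, f ≠ g → (1 / 65536 : ℝ) ≤ dist (φ f) (φ g) := by
    intro f hf g hg hfg
    have h1 : dist (φ f) (φ g) ^ 2 = ∑ i, (w f i - w g i) ^ 2 := by
      rw [dist_eq_norm, ← hnorm]
      simp [φ, sub_smul]
    have h2 : (∑ j, (f j - g j) ^ 2) / (16384 ^ 2 * m) ≤ dist (φ f) (φ g) ^ 2 := by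
      rw [h1, Fin.sum_univ_castSucc, Finset.sum_div]
      refine le_add_of_le_of_nonneg (Finset.sum_le_sum fun j _ => ?_) (by positivity)
      simp only [w, Fin.snoc_castSucc]
      rw [← sub_div, div_pow, mul_pow, Real.sq_sqrt hm0.le]
    have h3 : (1 / 65536 : ℝ) ^ 2 ≤ dist (φ f) (φ g) ^ 2 := by
      refine le_trans ?_ h2
      rw [le_div_iff₀ (by positivity)]
      have := hT3 f hf g hg hfg
      linarith
    exact abs_le_of_sq_le_sq' h3 dist_nonneg |>.2
  have hinj : Set.InjOn φ T := by
    intro f hf g hg hfg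
    by_contra hne
    have := hdist f hf g hg hne
    rw [hfg, dist_self] at this
    norm_num at this
  obtain ⟨T', hT', hcard⟩ := Finset.exists_subset_card_eq (ha.trans hT1)
  refine ⟨T'.image φ, ?_, ?_, ?_⟩
  · rw [Finset.card_image_of_injOn (hinj.mono (by exact_mod_cast hT')), hcard]
  · intro x hx
    obtain ⟨f, hf, rfl⟩ := Finset.mem_image.1 hx
    refine ⟨Submodule.sum_mem _ fun i _ => Submodule.smul_mem _ _ (Subtype.coe_prop _), ?_⟩
    have h1 : ∑ j, (f j / (16384 * √m)) ^ 2 ≤ 1 := by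
      calc ∑ j, (f j / (16384 * √m)) ^ 2 ≤ ∑ j : Fin m, 1 / (m : ℝ) := by
            refine Finset.sum_le_sum fun j _ => ?_
            have := hT2 f (hT' hf) j
            rw [div_pow, mul_pow, Real.sq_sqrt hm0.le, div_le_div_iff₀ (by positivity) hm0]
            have : f j ^ 2 ≤ 16384 ^ 2 := by gcongr; exacts [this.1, this.2]
            nlinarith
        _ = 1 := by simp [hm0.ne']
    have h2 : ‖φ f‖ ^ 2 = 1 := by
      rw [hnorm, Fin.sum_univ_castSucc]
      simp only [w, Fin.snoc_castSucc, Fin.snoc_last]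
      rw [Real.sq_sqrt (by linarith)]
      ring
    exact (pow_eq_one_iff_of_nonneg (norm_nonneg _) two_ne_zero).1 h2
  · intro x hx y hy hxy
    obtain ⟨f, hf, rfl⟩ := Finset.mem_image.1 hx
    obtain ⟨g, hg, rfl⟩ := Finset.mem_image.1 hy
    exact hdist f (hT' hf) g (hT' hg) fun h => hxy (by rw [h])

/-- Orthonormal frames are the paths of a tree: each term ranges over a sphere code in the
orthogonal complement of the earlier terms. With `b = 2^(d+1)` the bound `(b/2)^k` is exactly `2^(k
d)`. -/
theorem exists_orthonormal_code (k d : ℕ) (hk : 1 ≤ k) (hd : 2 * k ≤ d) :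
    ∃ T : Finset (Fin k → EuclideanSpace ℝ (Fin d)), (∀ f ∈ T, Orthonormal ℝ f) ∧
      2 ^ (k * d) ≤ T.card ∧
      ∀ f ∈ T, ∀ g ∈ T, f ≠ g →
        k * (1 / 131072 : ℝ) ^ 2 ≤ 2 * ∑ j, dist (f j) (g j) ^ 2 := by
  classical
  have hcode : ∀ l : List (EuclideanSpace ℝ (Fin d)), ∃ T : Finset (EuclideanSpace ℝ (Fin d)),
      (l.length < k → T.card = (2 ^ (d + 1)) ^ 2) ∧
      (∀ x ∈ T, x ∈ (Submodule.span ℝ (l.toFinset : Set (EuclideanSpace ℝ (Fin d))))ᗮ ∧ ‖x‖ = 1) ∧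
      ∀ x ∈ T, ∀ y ∈ T, x ≠ y → (1 / 65536 : ℝ) ≤ dist x y := by
    intro l
    by_cases hl : l.length < k
    · have h1 : Module.finrank ℝ (Submodule.span ℝ (l.toFinset : Set (EuclideanSpace ℝ (Fin d))))
          ≤ l.length := (finrank_span_finset_le_card _).trans (List.toFinset_card_le l)
      have h2 := (Submodule.span ℝ (l.toFinset : Set (EuclideanSpace ℝ (Fin d)))).finrank_add_finrank_orthogonal
      rw [finrank_euclideanSpace_fin] at h2
      -- At most `k - 1` vectors precede, so the complement has dimension at least `(d - k) + 1`. As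
      -- `2k ≤ d` and `d ≥ 2`, the code size `2^(2d+2)` is at most `2^(3d) ≤ 64^(d-k)`.
      obtain ⟨T, hT1, hT2, hT3⟩ := exists_sphere_code
        (Submodule.span ℝ (l.toFinset : Set (EuclideanSpace ℝ (Fin d))))ᗮ (d - k)
        ((2 ^ (d + 1)) ^ 2) (by omega) (by omega) (by
          rw [← pow_mul, show 64 = 2 ^ 6 by norm_num, ← pow_mul]
          exact Nat.pow_le_pow_right (by norm_num) (by omega))
      exact ⟨T, fun _ => hT1, hT2, hT3⟩
    · exact ⟨∅, fun h => absurd h hl, by simp, by simp⟩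
  choose c hc1 hc2 hc3 using hcode
  obtain ⟨T, h1, h2, h3⟩ := exists_separated_treePaths (2 ^ (d + 1)) Nat.one_le_two_pow (1 / 65536)
    (by norm_num) k hk c hc1 hc3
  refine ⟨T, fun f hf => ?_, ?_, fun f hf g hg hfg => ?_⟩
  · have horth : ∀ i j : Fin k, i < j → inner ℝ (f i) (f j) = 0 := by
      intro i j hij
      refine (Submodule.mem_orthogonal _ _).1 (hc2 _ _ (h1 f hf j)).1 _ (Submodule.subset_span ?_)
      simp only [List.coe_toFinset, Set.mem_ofPred_eq]
      rw [List.mem_take_iff_getElem]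
      exact ⟨i, by simp; omega, by simp⟩
    refine ⟨fun j => (hc2 _ _ (h1 f hf j)).2, fun i j hij => ?_⟩
    rcases lt_or_gt_of_ne hij with h | h
    · exact horth i j h
    · rw [real_inner_comm]; exact horth j i h
  · have : 2 ^ (k * d) * 2 ^ k ≤ T.card * 2 ^ k := by
      refine le_of_eq_of_le ?_ h2
      rw [← pow_mul, ← pow_add]
      ring_nf
    exact Nat.le_of_mul_le_mul_right this (by positivity)
  · have := h3 f hf g hg hfg
    norm_num at this ⊢
    exact this

theorem frob_sq {p q : ℕ} (M : Matrix (Fin p) (Fin q) ℝ) : frob M ^ 2 = ∑ i, ∑ j, M i j ^ 2 :=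
  Real.sq_sqrt (by positivity)

theorem exists_isStiefelPacking :
    ∃ (C : ℝ) (P : (k d : ℕ) → Finset (Matrix (Fin d) (Fin k) ℝ)),
      1 < C ∧ IsStiefelPacking C P := by
  classical
  have h : ∀ k d : ℕ, ∃ T : Finset (Matrix (Fin d) (Fin k) ℝ), 1 ≤ k → 2 * k ≤ d →
      (∀ Q ∈ T, Qᵀ * Q = 1) ∧ 2 ^ (k * d) ≤ T.card ∧
      ∀ Q ∈ T, ∀ Q' ∈ T, Q ≠ Q' → √(k : ℝ) / 262144 < frob (Q - Q') := by
    intro k d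
    by_cases hkd : 1 ≤ k ∧ 2 * k ≤ d
    · obtain ⟨T, h1, h2, h3⟩ := exists_orthonormal_code k d hkd.1 hkd.2
      let φ : (Fin k → EuclideanSpace ℝ (Fin d)) → Matrix (Fin d) (Fin k) ℝ :=
        fun f => Matrix.of fun i j => f j i
      have hφ : Function.Injective φ := by
        intro f g hfg
        ext j i
        exact congrFun (congrFun hfg i) j
      refine ⟨T.image φ, fun _ _ => ⟨?_, ?_, ?_⟩⟩
      · intro Q hQ
        obtain ⟨f, hf, rfl⟩ := Finset.mem_image.1 hQ
        ext i j
        have := (orthonormal_iff_ite.1 (h1 f hf)) i j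
        simp only [PiLp.inner_apply, RCLike.inner_apply, conj_trivial] at this
        simp only [φ, Matrix.mul_apply, Matrix.transpose_apply, Matrix.of_apply, Matrix.one_apply]
        simpa only [mul_comm] using this
      · rwa [Finset.card_image_of_injective _ hφ]
      · intro Q hQ Q' hQ' hne
        obtain ⟨f, hf, rfl⟩ := Finset.mem_image.1 hQ
        obtain ⟨g, hg, rfl⟩ := Finset.mem_image.1 hQ'
        have h4 := h3 f hf g hg fun h => hne (by rw [h])
        have h5 : frob (φ f - φ g) ^ 2 = ∑ j, dist (f j) (g j) ^ 2 := by
          rw [frob_sq, Finset.sum_comm]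
          simp [φ, EuclideanSpace.dist_sq_eq, Real.dist_eq]
        refine lt_of_pow_lt_pow_left₀ 2 (Real.sqrt_nonneg _) ?_
        have hk : (1 : ℝ) ≤ k := by exact_mod_cast hkd.1
        rw [div_pow, Real.sq_sqrt (by positivity), h5]
        linarith
    · exact ⟨∅, fun h1 h2 => absurd ⟨h1, h2⟩ hkd⟩
  choose P hP using h
  -- Squared distances are at least `k 2⁻³⁴ / 2 = k 2⁻³⁵`; taking `C = 2¹⁸` makes the inequality
  -- strict.
  exact ⟨262144, P, by norm_num, fun k d => hP k d⟩

/-! ## Change of measure -/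

/-- Two forms of one invariance: the left one passes to product measures, the right one is what
changes of variables use. -/
theorem map_withDensity_eq_self_iff {X : Type*} [MeasurableSpace X] (μ : Measure X)
    {f : X → ENNReal} (hf : Measurable f) {T : X → X} (hT : Measurable T) :
    (μ.withDensity f).map T = μ ↔
      ∀ G : X → ENNReal, Measurable G → ∫⁻ x, G x ∂μ = ∫⁻ x, G (T x) * f x ∂μ := by
  have h : ∀ G : X → ENNReal, Measurable G →
      ∫⁻ x, G x ∂(μ.withDensity f).map T = ∫⁻ x, G (T x) * f x ∂μ := fun G hG => by
    rw [lintegral_map hG hT,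
      lintegral_withDensity_eq_lintegral_mul μ hf (g := fun x => G (T x)) (hG.comp hT)]
    simp only [Pi.mul_apply, mul_comm]
  refine ⟨fun hμ G hG => by rw [← h G hG, hμ], fun hμ => Measure.ext_of_lintegral _ fun G hG => ?_⟩
  rw [h G hG, hμ G hG]

/-- It suffices to compare the two measures on boxes, where the density times the indicator is a
product of functions of independent coordinates. -/
theorem map_withDensity_pi {ι X : Type*} [Fintype ι] [MeasurableSpace X] (μ : ι → Measure X)
    [∀ i, IsProbabilityMeasure (μ i)] (f : ι → X → ENNReal) (hf : ∀ i, Measurable (f i))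
    (T : ι → X → X) (hT : ∀ i, Measurable (T i))
    (h : ∀ i, ((μ i).withDensity (f i)).map (T i) = μ i) :
    ((Measure.pi μ).withDensity fun x => ∏ i, f i (x i)).map (fun x i => T i (x i)) =
      Measure.pi μ := by
  symm
  refine Measure.pi_eq fun s hs => ?_
  have hTm : Measurable fun (x : ι → X) i => T i (x i) :=
    measurable_pi_lambda _ fun i => (hT i).comp (measurable_pi_apply i)
  rw [Measure.map_apply hTm (MeasurableSet.univ_pi hs),
    withDensity_apply _ (hTm (MeasurableSet.univ_pi hs)),
    ← lintegral_indicator (hTm (MeasurableSet.univ_pi hs))]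
  have h1 : ((fun (x : ι → X) i => T i (x i)) ⁻¹' Set.univ.pi s).indicator
      (fun x => ∏ i, f i (x i)) = fun x => ∏ i, ((T i ⁻¹' s i).indicator (f i)) (x i) := by
    funext x
    by_cases hx : ∀ i, T i (x i) ∈ s i
    · rw [Set.indicator_of_mem (by simpa using hx)]
      exact Finset.prod_congr rfl fun i _ => by rw [Set.indicator_of_mem (by simpa using hx i)]
    · rw [Set.indicator_of_notMem (by simpa using hx)]
      push Not at hx
      obtain ⟨i, hi⟩ := hx
      rw [Finset.prod_eq_zero (Finset.mem_univ i)]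
      rw [Set.indicator_of_notMem (by simpa using hi)]
  have hm : ∀ i, Measurable ((T i ⁻¹' s i).indicator (f i)) := fun i =>
    (hf i).indicator (hT i (hs i))
  rw [h1]
  have hind := iIndepFun_pi (μ := μ) (X := fun i => (T i ⁻¹' s i).indicator (f i))
    fun i => (hm i).aemeasurable
  have h2 := lintegral_prod_eq_prod_lintegral_of_indepFun Finset.univ
    (fun i (x : ι → X) => (T i ⁻¹' s i).indicator (f i) (x i)) hind
    fun i => (hm i).comp (measurable_pi_apply i)
  rw [h2]
  refine Finset.prod_congr rfl fun i _ => ?_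
  rw [(measurePreserving_eval μ i).lintegral_comp (hm i), lintegral_indicator (hT i (hs i)),
    ← withDensity_apply _ (hT i (hs i)), ← Measure.map_apply (hT i) (hs i), h i]

/-- The weight is the density of `N(-v, σ²)` with respect to `N(0, σ²)`, and translation by `v`
undoes it. -/
theorem gaussianReal_withDensity_shift (σ : ℝ) (hσ : 0 < σ) (v : ℝ) :
    ((gaussianReal 0 (Real.toNNReal (σ ^ 2))).withDensity
      fun a => ENNReal.ofReal (Real.exp (-((2 * (a * v) + v * v) / (2 * σ ^ 2))))).map (· + v) =
      gaussianReal 0 (Real.toNNReal (σ ^ 2)) := by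
  have hσ2 : (Real.toNNReal (σ ^ 2)) ≠ 0 := by
    simp [Real.toNNReal_eq_zero]; positivity
  have h : (gaussianReal 0 (Real.toNNReal (σ ^ 2))).withDensity
      (fun a => ENNReal.ofReal (Real.exp (-((2 * (a * v) + v * v) / (2 * σ ^ 2))))) =
      gaussianReal (-v) (Real.toNNReal (σ ^ 2)) := by
    rw [gaussianReal_of_var_ne_zero _ hσ2, gaussianReal_of_var_ne_zero _ hσ2,
      ← withDensity_mul _ (measurable_gaussianPDF _ _) (by fun_prop)]
    congr 1
    funext a
    rw [Pi.mul_apply, gaussianPDF, gaussianPDF, ← ENNReal.ofReal_mul (gaussianPDFReal_nonneg _ _ _),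
      gaussianPDFReal, gaussianPDFReal, mul_assoc, ← Real.exp_add, Real.coe_toNNReal _ (sq_nonneg σ)]
    congr 3
    field_simp
    ring
  rw [h, gaussianReal_map_add_const]
  simp

instance isProbabilityMeasure_noise (d : ℕ) (σ : ℝ) : IsProbabilityMeasure (noise d σ) := by
  unfold noise; infer_instance

theorem noise_withDensity_shift (d : ℕ) (σ : ℝ) (hσ : 0 < σ) (v : Fin d → ℝ) :
    ((noise d σ).withDensity fun a =>
      ENNReal.ofReal (Real.exp (-((2 * (a ⬝ᵥ v) + v ⬝ᵥ v) / (2 * σ ^ 2))))).map (· + v) =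
      noise d σ := by
  have h := map_withDensity_pi (fun _ : Fin d => gaussianReal 0 (Real.toNNReal (σ ^ 2)))
    (fun i a => ENNReal.ofReal (Real.exp (-((2 * (a * v i) + v i * v i) / (2 * σ ^ 2)))))
    (fun i => by fun_prop) (fun i a => a + v i) (fun i => by fun_prop)
    fun i => gaussianReal_withDensity_shift σ hσ (v i)
  unfold noise
  refine Eq.trans ?_ h
  congr 2
  funext a
  rw [← ENNReal.ofReal_prod_of_nonneg fun _ _ => (Real.exp_pos _).le, ← Real.exp_sum,
    Finset.sum_neg_distrib, ← Finset.sum_div, Finset.sum_add_distrib, ← Finset.mul_sum]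
  rfl

theorem lintegral_noise_shift (d : ℕ) (σ : ℝ) (hσ : 0 < σ) (v : Fin d → ℝ)
    (G : (Fin d → ℝ) → ENNReal) (hG : Measurable G) :
    ∫⁻ a, G a ∂noise d σ = ∫⁻ a, G (a + v) *
      ENNReal.ofReal (Real.exp (-((2 * (a ⬝ᵥ v) + v ⬝ᵥ v) / (2 * σ ^ 2)))) ∂noise d σ := by
  have hm : Measurable fun a : Fin d → ℝ =>
      ENNReal.ofReal (Real.exp (-((2 * (a ⬝ᵥ v) + v ⬝ᵥ v) / (2 * σ ^ 2)))) := by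
    unfold dotProduct; fun_prop
  exact (map_withDensity_eq_self_iff _ hm (by fun_prop)).1 (noise_withDensity_shift d σ hσ v) G hG

/-- A Donsker–Varadhan type bound for one event. -/
theorem mul_real_sub_integral_le_log_two {Ω Ω' : Type*} [MeasurableSpace Ω] [MeasurableSpace Ω']
    (μ : Measure Ω) [IsProbabilityMeasure μ] (Φ₀ Φ₁ : Ω → Ω') (h₀ : Measurable Φ₀)
    (h₁ : Measurable Φ₁) (ℓ : Ω → ℝ) (hℓ : Integrable ℓ μ)
    (h : ∀ G : Ω' → ENNReal, Measurable G →
      ∫⁻ ω, G (Φ₀ ω) ∂μ = ∫⁻ ω, G (Φ₁ ω) * ENNReal.ofReal (Real.exp (-ℓ ω)) ∂μ)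
    (S : Set Ω') (hS : MeasurableSet S) (τ : ℝ) (hτ : (μ.map Φ₀).real S ≤ Real.exp (-τ)) :
    τ * (μ.map Φ₁).real S - ∫ ω, ℓ ω ∂μ ≤ Real.log 2 := by
  -- The hypothesis on indicators says that `exp (-ℓ)` is the likelihood ratio of the law of `Φ₀` to
  -- that of `Φ₁`, pulled back to `Ω`. Integrability of `exp (-ℓ)` follows from the finiteness of
  -- the law of `Φ₀`.
  have key : ∀ U : Set Ω', MeasurableSet U →
      Integrable ((Φ₁ ⁻¹' U).indicator fun ω => Real.exp (-ℓ ω)) μ ∧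
      ∫ ω, (Φ₁ ⁻¹' U).indicator (fun ω => Real.exp (-ℓ ω)) ω ∂μ = (μ.map Φ₀).real U := by
    intro U hU
    have hint : ∫⁻ ω, ENNReal.ofReal ((Φ₁ ⁻¹' U).indicator (fun ω => Real.exp (-ℓ ω)) ω) ∂μ
        = (μ.map Φ₀) U := by
      have h1 := h (U.indicator 1) (measurable_one.indicator hU)
      rw [Measure.map_apply h₀ hU, ← lintegral_indicator_one (h₀ hU)]
      refine Eq.trans ?_ h1.symm
      refine lintegral_congr fun ω => ?_
      by_cases hω : Φ₁ ω ∈ U <;> simp [Set.indicator, hω]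
    have hnn : ∀ ω, 0 ≤ (Φ₁ ⁻¹' U).indicator (fun ω => Real.exp (-ℓ ω)) ω :=
      fun ω => Set.indicator_nonneg (fun _ _ => (Real.exp_pos _).le) ω
    have hmeas : AEStronglyMeasurable ((Φ₁ ⁻¹' U).indicator fun ω => Real.exp (-ℓ ω)) μ :=
      (Real.continuous_exp.comp_aestronglyMeasurable hℓ.1.neg).indicator (h₁ hU)
    have : IsProbabilityMeasure (μ.map Φ₀) := Measure.isProbabilityMeasure_map h₀.aemeasurable
    constructor
    · refine ⟨hmeas, ?_⟩
      rw [hasFiniteIntegral_iff_ofReal (Filter.Eventually.of_forall hnn), hint]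
      exact measure_lt_top _ _
    · rw [integral_eq_lintegral_of_nonneg_ae (Filter.Eventually.of_forall hnn) hmeas, hint]
      rfl
  have : IsProbabilityMeasure (μ.map Φ₀) := Measure.isProbabilityMeasure_map h₀.aemeasurable
  obtain ⟨i1, e1⟩ := key Set.univ MeasurableSet.univ
  obtain ⟨i2, e2⟩ := key S hS
  simp only [Set.preimage_univ, Set.indicator_univ] at i1 e1
  rw [probReal_univ] at e1
  set c : ℝ := τ * (μ.map Φ₁).real S - ∫ ω, ℓ ω ∂μ with hc
  let X : Ω → ℝ := fun ω => (Φ₁ ⁻¹' S).indicator (fun _ => τ) ω - ℓ ω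
  have iX : Integrable X μ := ((integrable_const τ).indicator (h₁ hS)).sub hℓ
  have eX : ∫ ω, X ω ∂μ = c := by
    rw [integral_sub ((integrable_const τ).indicator (h₁ hS)) hℓ, integral_indicator (h₁ hS)]
    simp [hc, map_measureReal_apply h₁ hS, mul_comm]
  -- Jensen's inequality for `exp` through its tangent line at the mean `c` of `X`. Integration
  -- gives `exp c ≤ 1 + (exp τ - 1) p`, with `p` the probability of `S` under the law of `Φ₀`, and
  -- `exp τ * p ≤ 1`.
  have hpt : ∀ ω, Real.exp c * (1 + (X ω - c)) ≤
      Real.exp (-ℓ ω) + (Real.exp τ - 1) * (Φ₁ ⁻¹' S).indicator (fun ω => Real.exp (-ℓ ω)) ω := by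
    intro ω
    calc Real.exp c * (1 + (X ω - c)) ≤ Real.exp c * Real.exp (X ω - c) := by
          gcongr; linarith [Real.add_one_le_exp (X ω - c)]
      _ = Real.exp (X ω) := by rw [← Real.exp_add]; ring_nf
      _ = _ := by
          by_cases hω : ω ∈ Φ₁ ⁻¹' S
          · simp only [X, Set.indicator_of_mem hω, sub_eq_add_neg, Real.exp_add]; ring
          · simp [X, Set.indicator_of_notMem hω]
  have iXc : Integrable (fun ω => X ω - c) μ := iX.sub (integrable_const c)
  have h2 : ∫ ω, Real.exp c * (1 + (X ω - c)) ∂μ ≤ _ :=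
    integral_mono (((integrable_const (1 : ℝ)).add iXc).const_mul (Real.exp c))
      (i1.add (i2.const_mul (Real.exp τ - 1))) hpt
  rw [integral_const_mul, integral_add (integrable_const _) iXc,
    integral_add' i1 (i2.const_mul _), integral_const_mul,
    integral_sub iX (integrable_const c), eX, e1, e2] at h2
  simp only [integral_const, probReal_univ, smul_eq_mul, one_mul, sub_self, add_zero, mul_one] at h2
  have h3 : Real.exp τ * (μ.map Φ₀).real S ≤ 1 := by
    calc _ ≤ Real.exp τ * Real.exp (-τ) := by gcongr
      _ = 1 := by rw [← Real.exp_add]; simp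
  have h4 : Real.exp c ≤ 2 := by nlinarith [measureReal_nonneg (μ := μ.map Φ₀) (s := S)]
  exact (Real.le_log_iff_exp_le two_pos).2 h4

/-! ## Frobenius norm and eigenvalue means -/

theorem frob_nonneg {p q : ℕ} (M : Matrix (Fin p) (Fin q) ℝ) : 0 ≤ frob M := Real.sqrt_nonneg _

theorem frob_sq_eq_trace {p q : ℕ} (M : Matrix (Fin p) (Fin q) ℝ) : frob M ^ 2 = (M * Mᵀ).trace := by
  rw [frob_sq]
  simp [Matrix.trace, Matrix.mul_apply, sq]

theorem frob_neg {p q : ℕ} (M : Matrix (Fin p) (Fin q) ℝ) : frob (-M) = frob M := by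
  simp [frob]

theorem frob_sub_comm {p q : ℕ} (M N : Matrix (Fin p) (Fin q) ℝ) : frob (M - N) = frob (N - M) := by
  rw [← frob_neg, neg_sub]

theorem frob_smul {p q : ℕ} (c : ℝ) (hc : 0 ≤ c) (M : Matrix (Fin p) (Fin q) ℝ) :
    frob (c • M) = c * frob M := by
  refine (pow_left_inj₀ (frob_nonneg _) (mul_nonneg hc (frob_nonneg _)) two_ne_zero).1 ?_
  rw [mul_pow, frob_sq, frob_sq]
  simp [Finset.mul_sum, mul_pow]

attribute [local instance] Matrix.frobeniusNormedAddCommGroup in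
theorem frob_sub_le {p q : ℕ} (M N L : Matrix (Fin p) (Fin q) ℝ) :
    frob (M - N) ≤ frob (L - M) + frob (L - N) := by
  have h : ∀ K : Matrix (Fin p) (Fin q) ℝ, frob K = ‖K‖ := fun K => by
    rw [Matrix.frobenius_norm_def, frob, Real.sqrt_eq_rpow]
    simp
  rw [frob_sub_comm L M]
  simp only [h]
  exact norm_sub_le_norm_sub_add_norm_sub _ _ _

theorem frob_mul_transpose_of_right {p q k : ℕ} (X : Matrix (Fin p) (Fin k) ℝ)
    (Y : Matrix (Fin q) (Fin k) ℝ) (hY : Yᵀ * Y = 1) : frob (X * Yᵀ) = frob X := by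
  refine (pow_left_inj₀ (frob_nonneg _) (frob_nonneg _) two_ne_zero).1 ?_
  rw [frob_sq_eq_trace, frob_sq_eq_trace, transpose_mul, transpose_transpose, Matrix.mul_assoc,
    ← Matrix.mul_assoc Yᵀ, hY, Matrix.one_mul]

theorem frob_transpose {p q : ℕ} (M : Matrix (Fin p) (Fin q) ℝ) : frob Mᵀ = frob M := by
  unfold frob
  rw [Finset.sum_comm]
  rfl

theorem frob_sq_of_orth {p k : ℕ} (X : Matrix (Fin p) (Fin k) ℝ) (hX : Xᵀ * X = 1) :
    frob X ^ 2 = k := by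
  rw [frob_sq_eq_trace, trace_mul_comm, hX]
  simp

theorem firstCols_eq_submatrix {d k : ℕ} (hk : k ≤ d) (V : Matrix (Fin d) (Fin d) ℝ) :
    firstCols V k = V.submatrix id (Fin.castLE hk) := by
  ext i j
  have : j.val < d := j.isLt.trans_le hk
  simp [firstCols, this, Fin.castLE]

theorem lastCols_eq_submatrix {d k : ℕ} (hk : k ≤ d) (V : Matrix (Fin d) (Fin d) ℝ) :
    lastCols V k = V.submatrix id (fun j => Fin.cast (Nat.sub_add_cancel hk) (Fin.natAdd (d - k) j)) := by
  ext i j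
  have : d - k + j.val < d := by omega
  simp [lastCols, this, Fin.cast, Fin.natAdd]

theorem submatrix_orth {d k : ℕ} (V : Matrix (Fin d) (Fin d) ℝ) (hV : Vᵀ * V = 1) (f : Fin k → Fin d)
    (hf : Function.Injective f) : (V.submatrix id f)ᵀ * V.submatrix id f = 1 := by
  rw [transpose_submatrix, ← submatrix_mul _ _ _ id _ Function.bijective_id, hV, submatrix_one _ hf]

theorem firstCols_orth {d k : ℕ} (hk : k ≤ d) (V : Matrix (Fin d) (Fin d) ℝ) (hV : Vᵀ * V = 1) :
    (firstCols V k)ᵀ * firstCols V k = 1 := by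
  rw [firstCols_eq_submatrix hk]
  exact submatrix_orth V hV _ (Fin.castLE_injective hk)

theorem lastCols_orth {d k : ℕ} (hk : k ≤ d) (V : Matrix (Fin d) (Fin d) ℝ) (hV : Vᵀ * V = 1) :
    (lastCols V k)ᵀ * lastCols V k = 1 := by
  rw [lastCols_eq_submatrix hk]
  exact submatrix_orth V hV _ ((Fin.cast_injective _).comp (Fin.natAdd_injective _ _))

namespace EigenDecomp

variable {d : ℕ} {M : Matrix (Fin d) (Fin d) ℝ} (E : EigenDecomp M)

theorem conj_eq : E.vecᵀ * M * E.vec = Matrix.diagonal E.val := by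
  calc E.vecᵀ * M * E.vec = E.vecᵀ * (E.vec * Matrix.diagonal E.val * E.vecᵀ) * E.vec :=
        congrArg (fun N => E.vecᵀ * N * E.vec) E.eq
    _ = (E.vecᵀ * E.vec) * Matrix.diagonal E.val * (E.vecᵀ * E.vec) := by
        simp only [Matrix.mul_assoc]
    _ = _ := by rw [E.orth, Matrix.one_mul, Matrix.mul_one]

theorem val_pos (hM : ∀ v : Fin d → ℝ, v ≠ 0 → 0 < v ⬝ᵥ (M *ᵥ v)) (i : Fin d) : 0 < E.val i := by
  have h1 : E.val i = E.vecᵀ i ⬝ᵥ (M *ᵥ E.vecᵀ i) := by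
    have := congrFun (congrFun E.conj_eq i) i
    rw [diagonal_apply_eq, Matrix.mul_assoc] at this
    rw [← this]
    rfl
  rw [h1]
  refine hM _ fun h => ?_
  have := congrFun (congrFun E.orth i) i
  rw [Matrix.mul_apply] at this
  simp [funext_iff] at h
  simp [h] at this

theorem sum_last {k : ℕ} (hk : k ≤ d) :
    ∑ i : Fin d with d - k ≤ i.val, E.val i =
      ∑ j : Fin k, E.val (Fin.cast (Nat.sub_add_cancel hk) (Fin.natAdd (d - k) j)) := by
  symm
  refine Finset.sum_bij (fun j _ => Fin.cast (Nat.sub_add_cancel hk) (Fin.natAdd (d - k) j))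
    (fun j _ => by simp; omega) (by simp [Fin.ext_iff]) ?_ (by simp)
  intro i hi
  simp only [Finset.mem_filter, Finset.mem_univ, true_and] at hi
  exact ⟨⟨i.val - (d - k), by omega⟩, Finset.mem_univ _, Fin.ext (by simp; omega)⟩

theorem trace_lastCols {k : ℕ} (hk1 : 1 ≤ k) (hk : k ≤ d) :
    ((lastCols E.vec k)ᵀ * M * lastCols E.vec k).trace = k * E.lowMean k := by
  have hk0 : (k : ℝ) ≠ 0 := by positivity
  rw [lowMean, mul_div_cancel₀ _ hk0, E.sum_last hk, lastCols_eq_submatrix hk, Matrix.trace]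
  refine Finset.sum_congr rfl fun j _ => ?_
  set f : Fin k → Fin d := fun j => Fin.cast (Nat.sub_add_cancel hk) (Fin.natAdd (d - k) j)
  have h := congrFun (congrFun E.conj_eq (f j)) (f j)
  rw [diagonal_apply_eq] at h
  exact h

theorem lowMean_pos (hv : ∀ i, 0 < E.val i) {k : ℕ} (hk1 : 1 ≤ k) (hk : k ≤ d) :
    0 < E.lowMean k := by
  have : 0 < (k : ℝ) := by positivity
  refine div_pos (Finset.sum_pos (fun i _ => hv i) ⟨⟨d - 1, by omega⟩, ?_⟩) this
  simp; omega

theorem highMean_pos (hv : ∀ i, 0 < E.val i) {k : ℕ} (hk1 : 1 ≤ k) (hk : k ≤ d) :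
    0 < E.highMean k := by
  have : 0 < (k : ℝ) := by positivity
  refine div_pos (Finset.sum_pos (fun i _ => hv i) ⟨⟨0, by omega⟩, ?_⟩) this
  simp; omega

/-- Ky Fan's maximum principle. -/
theorem trace_conj_le {k : ℕ} (hk1 : 1 ≤ k) (hk : k ≤ d) (R : Matrix (Fin d) (Fin k) ℝ)
    (hR : Rᵀ * R = 1) : (Rᵀ * M * R).trace ≤ k * E.highMean k := by
  have hk0 : (k : ℝ) ≠ 0 := by positivity
  rw [highMean, mul_div_cancel₀ _ hk0]
  have horth' : E.vec * E.vecᵀ = 1 := mul_eq_one_comm.1 E.orth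
  -- In the eigenbasis the trace is an average of the eigenvalues with weights `(B Bᵀ) i i`, which
  -- lie in `[0, 1]` because `B Bᵀ` is an orthogonal projection, and which sum to `k`.
  set B : Matrix (Fin d) (Fin k) ℝ := E.vecᵀ * R with hB
  have hBB : Bᵀ * B = 1 := by
    rw [hB, transpose_mul, transpose_transpose, Matrix.mul_assoc, ← Matrix.mul_assoc E.vec, horth',
      Matrix.one_mul, hR]
  have htr : (Rᵀ * M * R).trace = ∑ i, E.val i * (B * Bᵀ) i i := by
    have : Rᵀ * M * R = Bᵀ * (Matrix.diagonal E.val * B) := by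
      conv_lhs => rw [E.eq]
      simp only [hB, transpose_mul, transpose_transpose, Matrix.mul_assoc]
    rw [this, trace_mul_comm, Matrix.mul_assoc, Matrix.trace]
    simp [diagonal_mul]
  have hproj : (B * Bᵀ) * (B * Bᵀ) = B * Bᵀ := by
    rw [Matrix.mul_assoc, ← Matrix.mul_assoc Bᵀ, hBB, Matrix.one_mul]
  have hw0 : ∀ i, 0 ≤ (B * Bᵀ) i i := fun i => by
    rw [Matrix.mul_apply]
    exact Finset.sum_nonneg fun j _ => mul_self_nonneg _
  have hw1 : ∀ i, (B * Bᵀ) i i ≤ 1 := fun i => by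
    have h1 : (B * Bᵀ) i i = ∑ j, (B * Bᵀ) i j ^ 2 := by
      conv_lhs => rw [← hproj, Matrix.mul_apply]
      refine Finset.sum_congr rfl fun j _ => ?_
      rw [sq]
      congr 1
      simp [Matrix.mul_apply, mul_comm]
    have h2 : (B * Bᵀ) i i ^ 2 ≤ ∑ j, (B * Bᵀ) i j ^ 2 :=
      Finset.single_le_sum (f := fun j => (B * Bᵀ) i j ^ 2) (fun _ _ => sq_nonneg _)
        (Finset.mem_univ i)
    nlinarith [hw0 i]
  have hsum : ∑ i, (B * Bᵀ) i i = k := by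
    change (B * Bᵀ).trace = k
    rw [trace_mul_comm, hBB]
    simp
  have hcard : ∑ i : Fin d, (if i.val < k then (1 : ℝ) else 0) = k := by
    rw [Finset.sum_boole]
    norm_cast
    rw [Fin.card_filter_val_lt]
    omega
  -- The `k`-th largest eigenvalue serves as threshold: moving weight from indices `≥ k` to indices
  -- `< k` can only increase the sum.
  let p : Fin d := ⟨k - 1, by omega⟩
  have hterm : ∀ i : Fin d, (E.val i - E.val p) * ((B * Bᵀ) i i - if i.val < k then 1 else 0) ≤ 0 := by
    intro i
    split_ifs with hi
    · have : E.val p ≤ E.val i := E.anti (Fin.le_def.2 (by simp [p]; omega))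
      exact mul_nonpos_of_nonneg_of_nonpos (by linarith) (by linarith [hw1 i])
    · have : E.val i ≤ E.val p := E.anti (Fin.le_def.2 (by simp [p]; omega))
      exact mul_nonpos_of_nonpos_of_nonneg (by linarith) (by linarith [hw0 i])
  have h0 := Finset.sum_nonpos fun i (_ : i ∈ Finset.univ) => hterm i
  have hexp : ∑ i : Fin d, (E.val i - E.val p) * ((B * Bᵀ) i i - if i.val < k then 1 else 0) =
      (∑ i, E.val i * (B * Bᵀ) i i - ∑ i : Fin d, E.val i * (if i.val < k then 1 else 0)) -
        E.val p * (∑ i, (B * Bᵀ) i i - ∑ i : Fin d, (if i.val < k then (1 : ℝ) else 0)) := by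
    rw [← Finset.sum_sub_distrib, ← Finset.sum_sub_distrib, Finset.mul_sum,
      ← Finset.sum_sub_distrib]
    exact Finset.sum_congr rfl fun i _ => by ring
  rw [hexp, hsum, hcard] at h0
  simp only [mul_ite, mul_one, mul_zero, ← Finset.sum_filter] at h0
  rw [htr]
  linarith

end EigenDecomp

/-! ## From packings to lower bounds -/

theorem measurableSet_frob_sub_le {Ω : Type*} [MeasurableSpace Ω] {p q : ℕ}
    (est : Ω → Matrix (Fin p) (Fin q) ℝ) (hest : ∀ i j, Measurable fun z => est z i j)
    (A : Matrix (Fin p) (Fin q) ℝ) (ε : ℝ) : MeasurableSet {z | frob (est z - A) ≤ ε} := by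
  refine measurableSet_le ?_ measurable_const
  unfold frob
  simp only [Matrix.sub_apply]
  fun_prop

/-- The events are disjoint and avoid `B`, so their total mass is at most `δ`; among at least `2^m`
of them one has mass at most `δ / 2^m`, which is the exponential in the conclusion. -/
theorem exists_unlikely_event {Ω α : Type*} [MeasurableSpace Ω] (μ : Measure Ω)
    [IsProbabilityMeasure μ] (𝒬 : Finset α) (m : ℕ) (hm : 2 ^ m ≤ 𝒬.card) (B : Set Ω)
    (hB : MeasurableSet B) (Ev : α → Set Ω) (hEv : ∀ a, MeasurableSet (Ev a))
    (hdisj : ∀ a ∈ 𝒬, ∀ b ∈ 𝒬, a ≠ b → Disjoint (Ev a) (Ev b))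
    (hdisjB : ∀ a ∈ 𝒬, Disjoint (Ev a) B) (δ : ℝ) (hδ : 0 < δ) (hBδ : 1 - δ ≤ μ.real B) :
    ∃ a ∈ 𝒬, μ.real (Ev a) ≤ Real.exp (-(m * Real.log 2 + Real.log (1 / δ))) := by
  have hexp : Real.exp (-(m * Real.log 2 + Real.log (1 / δ))) = δ / 2 ^ m := by
    rw [neg_add, Real.exp_add, one_div, Real.log_inv, neg_neg, Real.exp_log hδ, Real.exp_neg,
      ← Real.log_pow, Real.exp_log (by positivity)]
    ring
  rw [hexp]
  by_contra! hcon
  have hne : 𝒬.Nonempty := Finset.card_pos.1 (lt_of_lt_of_le (by positivity) hm)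
  have h1 : δ < ∑ a ∈ 𝒬, μ.real (Ev a) := by
    calc δ = 2 ^ m * (δ / 2 ^ m) := by field_simp
      _ ≤ 𝒬.card * (δ / 2 ^ m) := by gcongr; exact_mod_cast hm
      _ = ∑ a ∈ 𝒬, δ / 2 ^ m := by simp
      _ < _ := Finset.sum_lt_sum_of_nonempty hne hcon
  rw [← measureReal_biUnion_finset (fun a ha b hb hab => hdisj a ha b hb hab) fun a _ => hEv a] at h1
  have h2 : μ.real (⋃ a ∈ 𝒬, Ev a) ≤ μ.real Bᶜ := by
    refine measureReal_mono ?_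
    simp only [Set.iUnion_subset_iff]
    exact fun a ha x hx => Set.disjoint_left.1 (hdisjB a ha) hx
  rw [probReal_compl_eq_one_sub hB] at h2
  linarith

/-- Fano-type lower bound on the information `K` needed to identify one of `2 ^ m` models. -/
theorem add_log_le_of_packing {Ω α : Type*} [MeasurableSpace Ω] {p q : ℕ}
    (law : Matrix (Fin p) (Fin q) ℝ → Measure Ω) (hlaw : ∀ A, IsProbabilityMeasure (law A))
    (est : Ω → Matrix (Fin p) (Fin q) ℝ) (hest : ∀ i j, Measurable fun z => est z i j)
    (A : Matrix (Fin p) (Fin q) ℝ) (𝒬 : Finset α) (D : α → Matrix (Fin p) (Fin q) ℝ)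
    (m : ℕ) (hm2 : 2 ≤ m) (hm : 2 ^ m ≤ 𝒬.card) (ε δ : ℝ) (hδ : 0 < δ) (hδ2 : δ ≤ 1 / 2)
    (hsep : ∀ a ∈ 𝒬, ∀ b ∈ 𝒬, a ≠ b → 2 * ε < frob (D a - D b))
    (hsepA : ∀ a ∈ 𝒬, 2 * ε < frob (D a - A))
    (hA : 1 - δ ≤ (law A).real {z | frob (est z - A) ≤ ε})
    (hD : ∀ a ∈ 𝒬, 1 - δ ≤ (law (D a)).real {z | frob (est z - D a) ≤ ε})
    (K : ℝ) (hK : ∀ a ∈ 𝒬, ∀ U : Set Ω, MeasurableSet U → ∀ τ : ℝ,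
      (law A).real U ≤ Real.exp (-τ) → τ * (law (D a)).real U ≤ Real.log 2 + K) :
    m + Real.log (1 / δ) ≤ 8 * K := by
  have hdisj : ∀ M N : Matrix (Fin p) (Fin q) ℝ, 2 * ε < frob (M - N) →
      Disjoint {z | frob (est z - M) ≤ ε} {z | frob (est z - N) ≤ ε} := by
    intro M N h
    refine Set.disjoint_left.2 fun z hz hz' => ?_
    have := frob_sub_le M N (est z)
    have h1 : frob (est z - M) ≤ ε := hz
    have h2 : frob (est z - N) ≤ ε := hz'
    linarith
  obtain ⟨a, ha, hsmall⟩ := exists_unlikely_event (law A) 𝒬 m hm {z | frob (est z - A) ≤ ε}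
    (measurableSet_frob_sub_le est hest A ε) (fun a => {z | frob (est z - D a) ≤ ε})
    (fun a => measurableSet_frob_sub_le est hest _ ε)
    (fun a ha b hb hab => hdisj _ _ (hsep a ha b hb hab)) (fun a ha => hdisj _ _ (hsepA a ha)) δ hδ hA
  have h1 := hK a ha _ (measurableSet_frob_sub_le est hest (D a) ε) _ hsmall
  have h2 := hD a ha
  have hlog2 := Real.log_two_gt_d9
  have hL : Real.log 2 ≤ Real.log (1 / δ) := by
    refine Real.log_le_log two_pos ?_
    rw [le_div_iff₀ hδ]
    linarith
  have hm2' : (2 : ℝ) ≤ m := by exact_mod_cast hm2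
  have h3 : (m * Real.log 2 + Real.log (1 / δ)) * (1 / 2) ≤ Real.log 2 + K := by
    refine le_trans (mul_le_mul_of_nonneg_left ?_ ?_) h1
    · linarith
    · have := mul_nonneg (by linarith : (0 : ℝ) ≤ m) (by linarith : 0 ≤ Real.log 2)
      linarith
  -- Since `m ≥ 2` and `log(1/δ) ≥ log 2`, the additive `log 2` is absorbed: the worst case of `4 (m
  -- log 2 + log(1/δ)) - 8 log 2 ≥ m + log(1/δ)` reduces to `3 log 2 ≥ 2`.
  nlinarith

/-- The law of the observations under `A` differs from that under `A + s X Yᵀ`, with `X` and `Y` of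
rank `k` with orthonormal columns, by an amount of information of at most `n s² tr (Yᵀ M Y) / σ²`. -/
def InfoBound {dx dy : ℕ} (law : (n : ℕ) → Matrix (Fin dy) (Fin dx) ℝ → Measure (Sample dx dy n))
    (A : Matrix (Fin dy) (Fin dx) ℝ) (M : Matrix (Fin dx) (Fin dx) ℝ) (σ : ℝ) (n k : ℕ) (s : ℝ) :
    Prop :=
  ∀ (X : Matrix (Fin dy) (Fin k) ℝ) (Y : Matrix (Fin dx) (Fin k) ℝ), Xᵀ * X = 1 → Yᵀ * Y = 1 →
    ∀ U : Set (Sample dx dy n), MeasurableSet U → ∀ τ : ℝ,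
      (law n A).real U ≤ Real.exp (-τ) →
      τ * (law n (A + s • (X * Yᵀ))).real U ≤
        Real.log 2 + n * s ^ 2 * (Yᵀ * M * Y).trace / σ ^ 2

/-- The scale `s` satisfies `s √k = 2Cε`. Hence packing distances above `√k / C` become distances
above `2ε`, while every perturbation has norm `2Cε > 2ε`. As `s² k = 4C²ε²`, each Fano bound gives a
cost of at most `32 C² ε²`. -/
theorem tradeoff_le_of_stableWith {dx dy : ℕ} (C : ℝ)
    (P : (k d : ℕ) → Finset (Matrix (Fin d) (Fin k) ℝ)) (hC : 1 < C) (hP : IsStiefelPacking C P)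
    (law : (n : ℕ) → Matrix (Fin dy) (Fin dx) ℝ → Measure (Sample dx dy n))
    (hlaw : ∀ n A, IsProbabilityMeasure (law n A))
    {A : Matrix (Fin dy) (Fin dx) ℝ} (S : SVD A)
    {M : Matrix (Fin dx) (Fin dx) ℝ} (E : EigenDecomp M) (hM : ∀ v, v ≠ 0 → 0 < v ⬝ᵥ (M *ᵥ v))
    (κ : ℕ → ℕ) (σ ε δ : ℝ) (hσ : 0 < σ) (hε : 0 < ε) (hδ : 0 < δ) (hδ2 : δ ≤ 1 / 2)
    (alg : Algorithm dx dy) (halg : ∀ n i j, Measurable fun z => alg n z i j)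
    (n : ℕ) (hn : 1 ≤ n) (hst : StableWith C P law S E κ ε δ alg n)
    (hk1 : 1 ≤ κ n) (hkx : 2 * κ n ≤ dx) (hky : 2 * κ n ≤ dy)
    (hinfo : InfoBound law A M σ n (κ n) (2 * C * ε / √(κ n : ℝ))) :
    gammaFn S E σ δ κ n ≤ 32 * C ^ 2 / Real.log 2 * ε ^ 2 := by
  unfold gammaFn tradeoff
  obtain ⟨hst1, hst2⟩ := hst
  set k := κ n with hk
  have hk0 : (0 : ℝ) < k := by exact_mod_cast hk1
  have hn0 : (0 : ℝ) < n := by exact_mod_cast hn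
  set s : ℝ := 2 * C * ε / √(k : ℝ) with hs
  have hs0 : 0 < s := by positivity
  have hs2 : s ^ 2 = 4 * C ^ 2 * ε ^ 2 / k := by
    rw [hs, div_pow, Real.sq_sqrt hk0.le]; ring
  have hsk : s * √(k : ℝ) = 2 * C * ε := div_mul_cancel₀ _ (by positivity)
  have hC0 : 0 < C := by linarith
  have hval := E.val_pos hM
  have hlow := E.lowMean_pos hval hk1 (by omega)
  have hhigh := E.highMean_pos hval hk1 (by omega)
  have hfar : ∀ {p q : ℕ} (X : Matrix (Fin p) (Fin k) ℝ) (Y : Matrix (Fin q) (Fin k) ℝ),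
      Xᵀ * X = 1 → Yᵀ * Y = 1 → 2 * ε < frob (s • (X * Yᵀ)) := by
    intro p q X Y hX hY
    have : frob X = √(k : ℝ) := by
      rw [← frob_sq_of_orth X hX, Real.sqrt_sq (frob_nonneg _)]
    rw [frob_smul _ hs0.le, frob_mul_transpose_of_right _ _ hY, this, hsk]
    nlinarith
  have hsepQ : ∀ {d : ℕ} (X X' : Matrix (Fin d) (Fin k) ℝ), √(k : ℝ) / C < frob (X - X') →
      2 * ε < s * frob (X - X') := by
    intro d X X' h
    calc 2 * ε = s * (√(k : ℝ) / C) := by rw [← mul_div_assoc, hsk]; field_simp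
      _ < _ := by gcongr
  have hWorth := lastCols_orth (k := k) (by omega) E.vec E.orth
  have hUorth := firstCols_orth (k := k) (by omega) S.U S.orthU
  have hA := hst2 A (Or.inl rfl)
  have final : ∀ (d : ℕ) (t lam : ℝ), 0 < lam → t ≤ k * lam →
      k * d + Real.log (1 / δ) ≤ 8 * (n * s ^ 2 * t / σ ^ 2) →
      σ ^ 2 * ((k * d + Real.log (1 / δ)) / (n * lam)) ≤ 32 * C ^ 2 * ε ^ 2 := by
    intro d t lam hlam ht h
    rw [← mul_div_assoc, div_le_iff₀ (by positivity)]
    calc σ ^ 2 * (k * d + Real.log (1 / δ)) ≤ σ ^ 2 * (8 * (n * s ^ 2 * t / σ ^ 2)) := by gcongr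
      _ = 8 * n * s ^ 2 * t := by field_simp
      _ ≤ 8 * n * s ^ 2 * (k * lam) := by gcongr
      _ = _ := by rw [hs2]; field_simp; ring
  have hY : k * dy + Real.log (1 / δ) ≤
      8 * (n * s ^ 2 * ((lastCols E.vec k)ᵀ * M * lastCols E.vec k).trace / σ ^ 2) := by
    obtain ⟨hP1, hP2, hP3⟩ := hP k dy hk1 hky
    have := add_log_le_of_packing (law n) (hlaw n) (alg n) (halg n) A (P k dy)
      (fun Q => A + s • (Q * (lastCols E.vec k)ᵀ)) (k * dy) (by nlinarith) hP2 ε δ hδ hδ2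
      (fun Q hQ Q' hQ' hne => by
        have := hsepQ Q Q' (hP3 Q hQ Q' hQ' hne)
        rw [add_sub_add_left_eq_sub, ← smul_sub, ← Matrix.sub_mul, frob_smul _ hs0.le,
          frob_mul_transpose_of_right _ _ hWorth]
        exact this)
      (fun Q hQ => by
        rw [add_sub_cancel_left]
        exact hfar _ _ (hP1 Q hQ) hWorth)
      hA (fun Q hQ => hst2 _ (Or.inr (Or.inl ⟨Q, hQ, rfl⟩)))
      _ (fun Q hQ => hinfo Q _ (hP1 Q hQ) hWorth)
    exact_mod_cast this
  have hX : k * dx + Real.log (1 / δ) ≤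
      8 * (n * s ^ 2 * (k * E.highMean k) / σ ^ 2) := by
    obtain ⟨hP1, hP2, hP3⟩ := hP k dx hk1 hkx
    have := add_log_le_of_packing (law n) (hlaw n) (alg n) (halg n) A (P k dx)
      (fun R => A + s • (firstCols S.U k * Rᵀ)) (k * dx) (by nlinarith) hP2 ε δ hδ hδ2
      (fun R hR R' hR' hne => by
        have := hsepQ R R' (hP3 R hR R' hR' hne)
        rw [add_sub_add_left_eq_sub, ← smul_sub, ← Matrix.mul_sub, ← transpose_sub,
          frob_smul _ hs0.le, ← frob_transpose, transpose_mul, transpose_transpose,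
          frob_mul_transpose_of_right _ _ hUorth]
        exact this)
      (fun R hR => by
        rw [add_sub_cancel_left]
        exact hfar _ _ hUorth (hP1 R hR))
      hA (fun R hR => hst2 _ (Or.inr (Or.inr ⟨R, hR, rfl⟩)))
      -- Here the directions `R` vary over the packing, so the trace is replaced by its Ky Fan
      -- bound, uniform in `R`.
      (n * s ^ 2 * (k * E.highMean k) / σ ^ 2) (fun R hR U hU τ hτ => by
        refine (hinfo _ R hUorth (hP1 R hR) U hU τ hτ).trans ?_
        have := E.trace_conj_le hk1 (by omega) R (hP1 R hR)
        gcongr)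
    exact_mod_cast this
  have h1 := final dy _ _ hlow (E.trace_lastCols hk1 (by omega)).le hY
  have h2 := final dx _ _ hhigh le_rfl hX
  have h3 : frob (A - S.trunc k) ^ 2 ≤ ε ^ 2 := by
    have := frob_nonneg (A - S.trunc k)
    gcongr
  have h4 : σ ^ 2 * max ((k * dy + Real.log (1 / δ)) / (n * E.lowMean k))
      ((k * dx + Real.log (1 / δ)) / (n * E.highMean k)) ≤ 32 * C ^ 2 * ε ^ 2 := by
    rw [mul_max_of_nonneg _ _ (sq_nonneg σ)]
    exact max_le h1 h2
  -- The squared approximation error adds at most `ε² ≤ C² ε²`, and `33 log 2 < 32` leaves room for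
  -- it.
  have h5 : 33 * C ^ 2 * ε ^ 2 ≤ 32 * C ^ 2 / Real.log 2 * ε ^ 2 := by
    rw [div_mul_eq_mul_div, le_div_iff₀ (Real.log_pos one_lt_two)]
    have := Real.log_two_lt_d9
    have h6 : 0 ≤ C ^ 2 * ε ^ 2 := by positivity
    nlinarith
  have h7 : ε ^ 2 ≤ C ^ 2 * ε ^ 2 := le_mul_of_one_le_left (sq_nonneg _) (by nlinarith)
  linarith

theorem optimalRank_mem {dx dy : ℕ} {A : Matrix (Fin dy) (Fin dx) ℝ} (S : SVD A)
    {M : Matrix (Fin dx) (Fin dx) ℝ} (E : EigenDecomp M) (σ δ : ℝ) (r n : ℕ) (hr : 1 ≤ r) :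
    optimalRank S E σ δ r n ∈ Set.Icc 1 r := by
  have hne : {k | k ∈ Set.Icc 1 r ∧
      ∀ j ∈ Set.Icc 1 r, tradeoff S E σ δ n k ≤ tradeoff S E σ δ n j}.Nonempty := by
    obtain ⟨k, hk, hmin⟩ := Set.exists_min_image (Set.Icc 1 r) (tradeoff S E σ δ n)
      (Set.finite_Icc 1 r) ⟨1, le_rfl, hr⟩
    exact ⟨k, hk, hmin⟩
  exact (Nat.sInf_mem hne).1

/-- The information bound is requested at the sample complexity only, because the smallness
condition in system identification is imposed there only. -/
theorem exists_isLeast_le_sampleComplexity {dx dy : ℕ} (C : ℝ)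
    (P : (k d : ℕ) → Finset (Matrix (Fin d) (Fin k) ℝ)) (hC : 1 < C) (hP : IsStiefelPacking C P)
    (law : (n : ℕ) → Matrix (Fin dy) (Fin dx) ℝ → Measure (Sample dx dy n))
    (hlaw : ∀ n A, IsProbabilityMeasure (law n A))
    {A : Matrix (Fin dy) (Fin dx) ℝ} (S : SVD A)
    {M : Matrix (Fin dx) (Fin dx) ℝ} (E : EigenDecomp M) (hM : ∀ v, v ≠ 0 → 0 < v ⬝ᵥ (M *ᵥ v))
    (r : ℕ) (hr : 1 ≤ r) (hrx : 2 * r ≤ dx) (hry : 2 * r ≤ dy)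
    (κ : ℕ → ℕ) (σ ε δ : ℝ) (hσ : 0 < σ) (hε : 0 < ε) (hδ : 0 < δ) (hδ2 : δ ≤ 1 / 2)
    (hκ : κ = optimalRank S E σ δ r ∨ ∀ n, 1 ≤ n → κ n ∈ Set.Icc 1 r)
    (alg : Algorithm dx dy) (halg : ∀ n i j, Measurable fun z => alg n z i j)
    (hst : IsStableAlg C P law S E κ ε δ alg)
    (hinfo : ∀ n, n = sampleComplexity C P law S E κ ε δ alg →
      InfoBound law A M σ n (κ n) (2 * C * ε / √(κ n : ℝ))) :
    ∃ n₀, IsLeast {n | 1 ≤ n ∧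
        gammaFn S E σ δ κ n ≤ 32 * C ^ 2 / Real.log 2 * ε ^ 2} n₀ ∧
      n₀ ≤ sampleComplexity C P law S E κ ε δ alg := by
  obtain ⟨hN1, hN2⟩ : sampleComplexity C P law S E κ ε δ alg ∈
      {n | 1 ≤ n ∧ StableWith C P law S E κ ε δ alg n} := Nat.sInf_mem hst
  have hk : κ (sampleComplexity C P law S E κ ε δ alg) ∈ Set.Icc 1 r := by
    rcases hκ with h | h
    · have := optimalRank_mem S E σ δ r (sampleComplexity C P law S E κ ε δ alg) hr
      rwa [← h] at this
    · exact h _ hN1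
  have hmem : sampleComplexity C P law S E κ ε δ alg ∈ {n | 1 ≤ n ∧
      gammaFn S E σ δ κ n ≤ 32 * C ^ 2 / Real.log 2 * ε ^ 2} :=
    ⟨hN1, tradeoff_le_of_stableWith C P hC hP law hlaw S E hM κ σ ε δ hσ hε hδ hδ2 alg halg _ hN1
      hN2 hk.1 (by have := hk.2; omega) (by have := hk.2; omega) (hinfo _ rfl)⟩
  exact ⟨_, ⟨Nat.sInf_mem ⟨_, hmem⟩, fun n hn => Nat.sInf_le hn⟩, Nat.sInf_le hmem⟩

/-! ## Expected log-likelihood ratios -/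

theorem dotProduct_self_smul_mul_transpose {p q k : ℕ} (X : Matrix (Fin p) (Fin k) ℝ)
    (Y : Matrix (Fin q) (Fin k) ℝ) (hX : Xᵀ * X = 1) (s : ℝ) (x : Fin q → ℝ) :
    ((s • (X * Yᵀ)) *ᵥ x) ⬝ᵥ ((s • (X * Yᵀ)) *ᵥ x) = s ^ 2 * ∑ j, (Yᵀ j ⬝ᵥ x) ^ 2 := by
  have h : ∀ u : Fin k → ℝ, (X *ᵥ u) ⬝ᵥ (X *ᵥ u) = u ⬝ᵥ u := fun u => by
    rw [dotProduct_mulVec, vecMul_mulVec, ← dotProduct_mulVec, hX, one_mulVec]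
  rw [smul_mulVec, ← mulVec_mulVec, smul_dotProduct, dotProduct_smul, h, smul_eq_mul, smul_eq_mul,
    ← mul_assoc, ← sq, dotProduct]
  congr 1
  exact Finset.sum_congr rfl fun j _ => (sq _).symm

theorem trace_transpose_mul_mul {q k : ℕ} (Y : Matrix (Fin q) (Fin k) ℝ)
    (M : Matrix (Fin q) (Fin q) ℝ) : (Yᵀ * M * Y).trace = ∑ j, Yᵀ j ⬝ᵥ (M *ᵥ Yᵀ j) := by
  rw [Matrix.mul_assoc]
  rfl

theorem memLp_dotProduct {Ω : Type*} [MeasurableSpace Ω] {μ : Measure Ω} {q : ℕ}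
    {x : Ω → Fin q → ℝ} (hx : ∀ i, MemLp (fun ω => x ω i) 2 μ) (v : Fin q → ℝ) :
    MemLp (fun ω => v ⬝ᵥ x ω) 2 μ := by
  unfold dotProduct
  exact memLp_finsetSum _ fun i _ => (hx i).const_mul (v i)

theorem integral_dotProduct_mul {Ω : Type*} [MeasurableSpace Ω] {μ : Measure Ω} {p q : ℕ}
    {x : Ω → Fin q → ℝ} {y : Ω → Fin p → ℝ} (hx : ∀ i, MemLp (fun ω => x ω i) 2 μ)
    (hy : ∀ i, MemLp (fun ω => y ω i) 2 μ) (v : Fin q → ℝ) (w : Fin p → ℝ) :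
    ∫ ω, (v ⬝ᵥ x ω) * (w ⬝ᵥ y ω) ∂μ = ∑ i, ∑ j, v i * w j * ∫ ω, x ω i * y ω j ∂μ := by
  have h : ∀ ω, (v ⬝ᵥ x ω) * (w ⬝ᵥ y ω) = ∑ i, ∑ j, v i * w j * (x ω i * y ω j) := fun ω => by
    simp only [dotProduct, Finset.sum_mul_sum]
    exact Finset.sum_congr rfl fun i _ => Finset.sum_congr rfl fun j _ => by ring
  have hint : ∀ i j, Integrable (fun ω => v i * w j * (x ω i * y ω j)) μ := fun i j =>
    ((hx i).integrable_mul (hy j)).const_mul _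
  simp only [h]
  rw [integral_finsetSum _ fun i _ => integrable_finsetSum _ fun j _ => hint i j]
  refine Finset.sum_congr rfl fun i _ => ?_
  rw [integral_finsetSum _ fun j _ => hint i j]
  exact Finset.sum_congr rfl fun j _ => integral_const_mul _ _

/-- The cross term vanishes because noise and covariates are uncorrelated. Orthonormality of the
columns of `X` reduces the quadratic term to the second moments of `x` along the columns of `Y`. -/
theorem integral_logRatio {Ω : Type*} [MeasurableSpace Ω] {μ : Measure Ω}
    {p q k : ℕ} {x : Ω → Fin q → ℝ} {η : Ω → Fin p → ℝ} (hx : ∀ i, MemLp (fun ω => x ω i) 2 μ)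
    (hη : ∀ i, MemLp (fun ω => η ω i) 2 μ) (h0 : ∀ i j, ∫ ω, η ω i * x ω j ∂μ = 0)
    (X : Matrix (Fin p) (Fin k) ℝ) (Y : Matrix (Fin q) (Fin k) ℝ) (hX : Xᵀ * X = 1) (s σ : ℝ) :
    let Δ := s • (X * Yᵀ)
    Integrable (fun ω => (2 * (η ω ⬝ᵥ (Δ *ᵥ x ω)) + (Δ *ᵥ x ω) ⬝ᵥ (Δ *ᵥ x ω)) / (2 * σ ^ 2)) μ ∧
    ∫ ω, (2 * (η ω ⬝ᵥ (Δ *ᵥ x ω)) + (Δ *ᵥ x ω) ⬝ᵥ (Δ *ᵥ x ω)) / (2 * σ ^ 2) ∂μ =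
      s ^ 2 * (∑ j, ∫ ω, (Yᵀ j ⬝ᵥ x ω) ^ 2 ∂μ) / (2 * σ ^ 2) := by
  intro Δ
  have e1 : ∀ ω, η ω ⬝ᵥ (Δ *ᵥ x ω) = ∑ i, ∑ j, Δ i j * (η ω i * x ω j) := fun ω => by
    simp only [dotProduct, mulVec, Finset.mul_sum]
    exact Finset.sum_congr rfl fun i _ => Finset.sum_congr rfl fun j _ => by ring
  have hint : ∀ i j, Integrable (fun ω => Δ i j * (η ω i * x ω j)) μ := fun i j =>
    ((hη i).integrable_mul (hx j)).const_mul _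
  have i1 : Integrable (fun ω => η ω ⬝ᵥ (Δ *ᵥ x ω)) μ := by
    simp only [e1]
    exact integrable_finsetSum _ fun i _ => integrable_finsetSum _ fun j _ => hint i j
  have z1 : ∫ ω, η ω ⬝ᵥ (Δ *ᵥ x ω) ∂μ = 0 := by
    simp only [e1]
    rw [integral_finsetSum _ fun i _ => integrable_finsetSum _ fun j _ => hint i j]
    refine Finset.sum_eq_zero fun i _ => ?_
    rw [integral_finsetSum _ fun j _ => hint i j]
    refine Finset.sum_eq_zero fun j _ => ?_
    rw [integral_const_mul, h0, mul_zero]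
  have e2 : ∀ ω, (Δ *ᵥ x ω) ⬝ᵥ (Δ *ᵥ x ω) = s ^ 2 * ∑ j, (Yᵀ j ⬝ᵥ x ω) ^ 2 := fun ω =>
    dotProduct_self_smul_mul_transpose X Y hX s (x ω)
  have hint2 : ∀ j, Integrable (fun ω => (Yᵀ j ⬝ᵥ x ω) ^ 2) μ := fun j =>
    (memLp_dotProduct hx (Yᵀ j)).integrable_sq
  have i2 : Integrable (fun ω => (Δ *ᵥ x ω) ⬝ᵥ (Δ *ᵥ x ω)) μ := by
    simp only [e2]
    exact (integrable_finsetSum _ fun j _ => hint2 j).const_mul _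
  refine ⟨((i1.const_mul 2).add i2).div_const _, ?_⟩
  rw [integral_div, integral_add (i1.const_mul 2) i2, integral_const_mul, z1, mul_zero, zero_add]
  simp only [e2]
  rw [integral_const_mul, integral_finsetSum _ fun j _ => hint2 j]

theorem memLp_noise (d : ℕ) (σ : ℝ) (i : Fin d) : MemLp (fun a : Fin d → ℝ => a i) 2 (noise d σ) :=
  (memLp_id_gaussianReal 2).comp_measurePreserving
    (measurePreserving_eval (fun _ : Fin d => gaussianReal 0 (Real.toNNReal (σ ^ 2))) i)

theorem integral_noise (d : ℕ) (σ : ℝ) (i : Fin d) : ∫ a, a i ∂noise d σ = 0 := by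
  have h := integral_comp_eval (μ := fun _ : Fin d => gaussianReal 0 (Real.toNNReal (σ ^ 2)))
    (i := i) (f := fun x => x) (by fun_prop)
  rw [integral_id_gaussianReal] at h
  exact h

theorem integral_mul_noise (d : ℕ) (σ : ℝ) (i j : Fin d) :
    ∫ a, a i * a j ∂noise d σ = if i = j then σ ^ 2 else 0 := by
  split_ifs with h
  · subst h
    have h1 : ∫ x, x * x ∂gaussianReal 0 (Real.toNNReal (σ ^ 2)) = σ ^ 2 := by
      have h2 := variance_id_gaussianReal (μ := 0) (v := Real.toNNReal (σ ^ 2))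
      rw [variance_eq_integral aemeasurable_id] at h2
      simp only [id, integral_id_gaussianReal, sub_zero] at h2
      simp only [← sq]
      rw [h2, Real.coe_toNNReal _ (sq_nonneg σ)]
    refine Eq.trans ?_ h1
    exact integral_comp_eval (μ := fun _ : Fin d => gaussianReal 0 (Real.toNNReal (σ ^ 2)))
      (i := i) (f := fun x => x * x) (by fun_prop)
  · have hind : IndepFun (fun a : Fin d → ℝ => a i) (fun a => a j) (noise d σ) :=
      (iIndepFun_pi (μ := fun _ : Fin d => gaussianReal 0 (Real.toNNReal (σ ^ 2)))
        (X := fun _ x => x) fun _ => aemeasurable_id).indepFun h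
    rw [hind.integral_fun_mul_eq_mul_integral (measurable_pi_apply i).aestronglyMeasurable
      (measurable_pi_apply j).aestronglyMeasurable, integral_noise, zero_mul]

/-! ## Multivariate regression -/

theorem integral_dotProduct_sq_eq {d : ℕ} (ν : Measure (Fin d → ℝ))
    (hν : ∀ i, MemLp (fun x : Fin d → ℝ => x i) 2 ν) (v : Fin d → ℝ) :
    ∫ x, (v ⬝ᵥ x) ^ 2 ∂ν = v ⬝ᵥ (secondMoment ν *ᵥ v) := by
  simp only [sq]
  rw [integral_dotProduct_mul (x := fun x => x) (y := fun x => x) hν hν v v]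
  simp only [dotProduct, mulVec, secondMoment, Matrix.of_apply, Finset.mul_sum]
  exact Finset.sum_congr rfl fun i _ => Finset.sum_congr rfl fun j _ => by ring

/-- For fixed `x` this is the translation formula for the noise with vector `Δ x`; Fubini does the
rest. -/
theorem prod_noise_withDensity_shift {dx dy : ℕ} (ν : Measure (Fin dx → ℝ)) [IsProbabilityMeasure ν]
    (σ : ℝ) (hσ : 0 < σ) (Δ : Matrix (Fin dy) (Fin dx) ℝ) :
    ((ν.prod (noise dy σ)).withDensity fun p => ENNReal.ofReal (Real.exp
      (-((2 * (p.2 ⬝ᵥ (Δ *ᵥ p.1)) + (Δ *ᵥ p.1) ⬝ᵥ (Δ *ᵥ p.1)) / (2 * σ ^ 2))))).map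
      (fun p => (p.1, p.2 + Δ *ᵥ p.1)) = ν.prod (noise dy σ) := by
  have hm : Measurable fun p : (Fin dx → ℝ) × (Fin dy → ℝ) => ENNReal.ofReal (Real.exp
      (-((2 * (p.2 ⬝ᵥ (Δ *ᵥ p.1)) + (Δ *ᵥ p.1) ⬝ᵥ (Δ *ᵥ p.1)) / (2 * σ ^ 2)))) := by
    unfold mulVec dotProduct; fun_prop
  have hT : Measurable fun p : (Fin dx → ℝ) × (Fin dy → ℝ) => (p.1, p.2 + Δ *ᵥ p.1) := by
    unfold mulVec dotProduct; fun_prop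
  refine (map_withDensity_eq_self_iff _ hm hT).2 fun G hG => ?_
  have hGT : Measurable fun p : (Fin dx → ℝ) × (Fin dy → ℝ) => G (p.1, p.2 + Δ *ᵥ p.1) := hG.comp hT
  rw [lintegral_prod _ (hGT.fun_mul hm).aemeasurable, lintegral_prod _ hG.aemeasurable]
  exact lintegral_congr fun x =>
    lintegral_noise_shift dy σ hσ (Δ *ᵥ x) (fun a => G (x, a)) (by fun_prop)

theorem measurable_regression_map {dx dy : ℕ} (A : Matrix (Fin dy) (Fin dx) ℝ) :
    Measurable fun p : (Fin dx → ℝ) × (Fin dy → ℝ) => (p.1, A *ᵥ p.1 + p.2) := by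
  unfold mulVec dotProduct; fun_prop

theorem isProbabilityMeasure_regressionLaw {dx dy : ℕ} (ν : Measure (Fin dx → ℝ))
    [IsProbabilityMeasure ν] (σ : ℝ) (n : ℕ) (A : Matrix (Fin dy) (Fin dx) ℝ) :
    IsProbabilityMeasure (regressionLaw ν σ n A) := by
  have := Measure.isProbabilityMeasure_map (μ := ν.prod (noise dy σ))
    (measurable_regression_map A).aemeasurable
  unfold regressionLaw
  infer_instance

theorem regressionLaw_eq_map {dx dy : ℕ} (ν : Measure (Fin dx → ℝ))
    [IsProbabilityMeasure ν] (σ : ℝ) (n : ℕ) (A : Matrix (Fin dy) (Fin dx) ℝ) :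
    regressionLaw ν σ n A = (Measure.pi fun _ : Fin n => ν.prod (noise dy σ)).map
      fun ω i => ((ω i).1, A *ᵥ (ω i).1 + (ω i).2) := by
  have := Measure.isProbabilityMeasure_map (μ := ν.prod (noise dy σ))
    (measurable_regression_map A).aemeasurable
  exact (Measure.pi_map_pi (μ := fun _ : Fin n => ν.prod (noise dy σ))
    fun _ => (measurable_regression_map A).aemeasurable).symm

theorem infoBound_regressionLaw {dx dy : ℕ} (ν : Measure (Fin dx → ℝ)) [IsProbabilityMeasure ν]
    (hν : ∀ i, MemLp (fun x : Fin dx → ℝ => x i) 2 ν) (σ : ℝ) (hσ : 0 < σ)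
    (A : Matrix (Fin dy) (Fin dx) ℝ) (n k : ℕ) (s : ℝ) :
    InfoBound (regressionLaw ν σ) A (secondMoment ν) σ n k s := by
  intro X Y hX hY U hU τ hτ
  set Δ := s • (X * Yᵀ) with hΔ
  set μ₁ := ν.prod (noise dy σ) with hμ₁
  let ℓ : (Fin dx → ℝ) × (Fin dy → ℝ) → ℝ := fun p =>
    (2 * (p.2 ⬝ᵥ (Δ *ᵥ p.1)) + (Δ *ᵥ p.1) ⬝ᵥ (Δ *ᵥ p.1)) / (2 * σ ^ 2)
  have hx : ∀ i, MemLp (fun p : (Fin dx → ℝ) × (Fin dy → ℝ) => p.1 i) 2 μ₁ := fun i =>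
    (hν i).comp_measurePreserving measurePreserving_fst
  have hη : ∀ i, MemLp (fun p : (Fin dx → ℝ) × (Fin dy → ℝ) => p.2 i) 2 μ₁ := fun i =>
    (memLp_noise dy σ i).comp_measurePreserving measurePreserving_snd
  obtain ⟨hℓ1, hℓ2⟩ := integral_logRatio hx hη (fun i j => by
    have := integral_prod_mul (μ := ν) (ν := noise dy σ) (fun x => x j) (fun a => a i)
    rw [integral_noise, mul_zero] at this
    simpa only [mul_comm] using this) X Y hX s σ
  have hsq : ∀ j, ∫ p, (Yᵀ j ⬝ᵥ p.1) ^ 2 ∂μ₁ = Yᵀ j ⬝ᵥ (secondMoment ν *ᵥ Yᵀ j) := fun j => by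
    rw [← integral_dotProduct_sq_eq ν hν]
    exact integral_fun_fst (μ := ν) (ν := noise dy σ) (fun x => (Yᵀ j ⬝ᵥ x) ^ 2) |>.trans (by simp)
  simp only [hsq] at hℓ2
  rw [← trace_transpose_mul_mul] at hℓ2
  have hℓm : Measurable ℓ := by
    unfold ℓ mulVec dotProduct; fun_prop
  have hTm : Measurable fun p : (Fin dx → ℝ) × (Fin dy → ℝ) => (p.1, p.2 + Δ *ᵥ p.1) := by
    unfold mulVec dotProduct; fun_prop
  have hshift := map_withDensity_pi (fun _ : Fin n => μ₁)
    (fun _ p => ENNReal.ofReal (Real.exp (-ℓ p))) (fun _ => by fun_prop)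
    (fun _ p => (p.1, p.2 + Δ *ᵥ p.1)) (fun _ => hTm)
    (fun _ => prod_noise_withDensity_shift ν σ hσ Δ)
  have hΦ : ∀ B : Matrix (Fin dy) (Fin dx) ℝ, Measurable
      fun (ω : Fin n → (Fin dx → ℝ) × (Fin dy → ℝ)) i => ((ω i).1, B *ᵥ (ω i).1 + (ω i).2) :=
    fun B => measurable_pi_lambda _ fun i => (measurable_regression_map B).comp (measurable_pi_apply i)
  have hint : ∀ i : Fin n, Integrable (fun ω : Fin n → (Fin dx → ℝ) × (Fin dy → ℝ) => ℓ (ω i))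
      (Measure.pi fun _ : Fin n => μ₁) := fun i =>
    integrable_comp_eval (μ := fun _ : Fin n => μ₁) hℓ1
  -- Both laws are images of the same noise: feeding the noise `η + Δ x` to the model `A` yields the
  -- data of the model `A + Δ` with noise `η`.
  have hDV := mul_real_sub_integral_le_log_two (Measure.pi fun _ : Fin n => μ₁) _ _ (hΦ A) (hΦ (A + Δ))
    (fun ω => ∑ i, ℓ (ω i)) (integrable_finsetSum _ fun i _ => hint i) (fun G hG => by
      have hTm' : Measurable fun (ω : Fin n → (Fin dx → ℝ) × (Fin dy → ℝ)) i =>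
          ((ω i).1, (ω i).2 + Δ *ᵥ (ω i).1) :=
        measurable_pi_lambda _ fun i => hTm.comp (measurable_pi_apply i)
      refine ((map_withDensity_eq_self_iff _ (by fun_prop) hTm').1 hshift _
        (hG.comp (hΦ A))).trans (lintegral_congr fun ω => ?_)
      rw [← ENNReal.ofReal_prod_of_nonneg fun _ _ => (Real.exp_pos _).le,
        ← Real.exp_sum, Finset.sum_neg_distrib]
      congr 1
      refine congrArg G (funext fun i => ?_)
      simp only [add_mulVec, Prod.mk.injEq, true_and]
      abel) U hU τ (by rwa [regressionLaw_eq_map] at hτ)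
  rw [← regressionLaw_eq_map] at hDV
  have hsum : ∫ ω, ∑ i, ℓ (ω i) ∂(Measure.pi fun _ : Fin n => μ₁) =
      n * (s ^ 2 * (Yᵀ * secondMoment ν * Y).trace / (2 * σ ^ 2)) := by
    rw [integral_finsetSum _ fun i _ => hint i]
    simp only [integral_comp_eval (μ := fun _ : Fin n => μ₁) (f := ℓ) hℓ1.1]
    rw [← hℓ2]
    simp [ℓ, hΔ]
  rw [hsum] at hDV
  have htr : 0 ≤ (Yᵀ * secondMoment ν * Y).trace := by
    rw [trace_transpose_mul_mul]
    refine Finset.sum_nonneg fun j _ => ?_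
    rw [← integral_dotProduct_sq_eq ν hν]
    exact integral_nonneg fun _ => sq_nonneg _
  -- The Gaussian information carries a factor `1/2` that `InfoBound` gives away; system
  -- identification needs it.
  have h2 : n * (s ^ 2 * (Yᵀ * secondMoment ν * Y).trace / (2 * σ ^ 2)) ≤
      n * s ^ 2 * (Yᵀ * secondMoment ν * Y).trace / σ ^ 2 := by
    have h3 : 0 ≤ n * s ^ 2 * (Yᵀ * secondMoment ν * Y).trace / σ ^ 2 := by positivity
    have h4 : n * (s ^ 2 * (Yᵀ * secondMoment ν * Y).trace / (2 * σ ^ 2)) =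
      (n * s ^ 2 * (Yᵀ * secondMoment ν * Y).trace / σ ^ 2) / 2 := by field_simp
    linarith
  linarith

/-! ## The Gramian -/

-- Gelfand's formula for the complexified matrix; the row-sum norm dominates every entry.
attribute [local instance] Matrix.linftyOpNormedRing Matrix.linftyOpNormedAlgebra in
theorem exists_norm_pow_apply_le {d : ℕ} (A : Matrix (Fin d) (Fin d) ℝ)
    (hA : spectralRadius ℂ (A.map (algebraMap ℝ ℂ)) < 1) :
    ∃ r : ℝ, 0 ≤ r ∧ r < 1 ∧ ∀ᶠ t : ℕ in Filter.atTop, ∀ i j, |(A ^ t) i j| ≤ r ^ t := by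
  obtain ⟨r, hr1, hr2⟩ := ENNReal.lt_iff_exists_nnreal_btwn.1 hA
  have : CompleteSpace (Matrix (Fin d) (Fin d) ℂ) := FiniteDimensional.complete ℂ _
  have h := spectrum.pow_nnnorm_pow_one_div_tendsto_nhds_spectralRadius (A.map (algebraMap ℝ ℂ))
  refine ⟨r, r.coe_nonneg, by exact_mod_cast hr2, ?_⟩
  filter_upwards [h.eventually_lt_const hr1, Filter.eventually_gt_atTop 0] with t ht ht0 i j
  have h1 : ‖(A.map (algebraMap ℝ ℂ)) ^ t‖₊ ≤ r ^ t := by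
    have h2 := ENNReal.rpow_le_rpow ht.le (z := (t : ℝ)) (by positivity)
    rw [← ENNReal.rpow_mul, one_div, inv_mul_cancel₀ (by positivity), ENNReal.rpow_one,
      ENNReal.rpow_natCast] at h2
    exact_mod_cast h2
  have h3 : (A.map (algebraMap ℝ ℂ)) ^ t = (A ^ t).map (algebraMap ℝ ℂ) :=
    (map_pow (algebraMap ℝ ℂ).mapMatrix A t).symm
  rw [h3, Matrix.linfty_opNNNorm_def] at h1
  have h4 : ‖((A ^ t).map (algebraMap ℝ ℂ)) i j‖₊ ≤ r ^ t :=
    ((Finset.single_le_sum (f := fun j => ‖((A ^ t).map (algebraMap ℝ ℂ)) i j‖₊)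
      (fun _ _ => zero_le) (Finset.mem_univ j)).trans
      (Finset.le_sup (f := fun i => ∑ j, ‖((A ^ t).map (algebraMap ℝ ℂ)) i j‖₊)
        (Finset.mem_univ i))).trans h1
  have h5 : ‖((A ^ t).map (algebraMap ℝ ℂ)) i j‖ ≤ (r : ℝ) ^ t := by exact_mod_cast h4
  simpa using h5

theorem summable_gramian {d : ℕ} (A : Matrix (Fin d) (Fin d) ℝ)
    (hA : spectralRadius ℂ (A.map (algebraMap ℝ ℂ)) < 1) :
    Summable fun t : ℕ => A ^ t * (A ^ t)ᵀ := by
  obtain ⟨r, hr0, hr1, h⟩ := exists_norm_pow_apply_le A hA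
  refine Pi.summable.2 fun i => Pi.summable.2 fun j => ?_
  have hg : Summable fun t : ℕ => (d : ℝ) * (r ^ 2) ^ t :=
    (summable_geometric_of_lt_one (by positivity) (by nlinarith)).mul_left _
  refine Summable.of_norm_bounded_eventually_nat hg ?_
  filter_upwards [h] with t ht
  rw [Matrix.mul_apply, Real.norm_eq_abs]
  calc |∑ l, (A ^ t) i l * (A ^ t)ᵀ l j| ≤ ∑ l, |(A ^ t) i l * (A ^ t)ᵀ l j| :=
        Finset.abs_sum_le_sum_abs _ _
    _ ≤ ∑ l : Fin d, r ^ t * r ^ t := by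
        refine Finset.sum_le_sum fun l _ => ?_
        rw [abs_mul]
        exact mul_le_mul (ht i l) (ht j l) (abs_nonneg _) (by positivity)
    _ = d * (r ^ 2) ^ t := by
        rw [Finset.sum_const, Finset.card_univ, Fintype.card_fin, nsmul_eq_mul]; ring

/-- The Lyapunov equation, obtained by splitting off the term `t = 0` of the series. -/
theorem gramian_eq {d : ℕ} (A : Matrix (Fin d) (Fin d) ℝ)
    (hA : spectralRadius ℂ (A.map (algebraMap ℝ ℂ)) < 1) : gramian A = 1 + A * gramian A * Aᵀ := by
  have hs := summable_gramian A hA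
  conv_lhs => rw [gramian, hs.tsum_eq_zero_add]
  rw [gramian, ← hs.tsum_mul_left, ← (hs.mul_left A).tsum_mul_right]
  simp only [pow_zero, transpose_one, Matrix.mul_one, pow_succ', transpose_mul, Matrix.mul_assoc]

theorem gramian_transpose {d : ℕ} (A : Matrix (Fin d) (Fin d) ℝ) : (gramian A)ᵀ = gramian A := by
  rw [gramian, Matrix.transpose_tsum]
  simp [transpose_mul]

theorem gramian_form_nonneg {d : ℕ} (A : Matrix (Fin d) (Fin d) ℝ)
    (hA : spectralRadius ℂ (A.map (algebraMap ℝ ℂ)) < 1) (u : Fin d → ℝ) : 0 ≤ u ⬝ᵥ (gramian A *ᵥ u) := by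
  let φ : Matrix (Fin d) (Fin d) ℝ →+ ℝ :=
    { toFun := fun N => u ⬝ᵥ (N *ᵥ u)
      map_zero' := by simp
      map_add' := fun N N' => by rw [add_mulVec, dotProduct_add] }
  have hφ : Continuous φ := by
    change Continuous fun N : Matrix (Fin d) (Fin d) ℝ => u ⬝ᵥ (N *ᵥ u)
    fun_prop
  refine ((summable_gramian A hA).hasSum.map φ hφ).nonneg fun t => ?_
  change 0 ≤ u ⬝ᵥ ((A ^ t * (A ^ t)ᵀ) *ᵥ u)
  rw [← mulVec_mulVec, dotProduct_mulVec, ← mulVec_transpose]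
  exact Finset.sum_nonneg fun _ _ => mul_self_nonneg _

theorem gramian_form_eq {d : ℕ} (A : Matrix (Fin d) (Fin d) ℝ)
    (hA : spectralRadius ℂ (A.map (algebraMap ℝ ℂ)) < 1) (u : Fin d → ℝ) :
    u ⬝ᵥ (gramian A *ᵥ u) = u ⬝ᵥ u + (Aᵀ *ᵥ u) ⬝ᵥ (gramian A *ᵥ (Aᵀ *ᵥ u)) := by
  conv_lhs => rw [gramian_eq A hA]
  rw [add_mulVec, dotProduct_add, one_mulVec, ← mulVec_mulVec, ← mulVec_mulVec, dotProduct_mulVec u A,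
    ← mulVec_transpose]

theorem self_le_gramian_form {d : ℕ} (A : Matrix (Fin d) (Fin d) ℝ)
    (hA : spectralRadius ℂ (A.map (algebraMap ℝ ℂ)) < 1) (u : Fin d → ℝ) : u ⬝ᵥ u ≤ u ⬝ᵥ (gramian A *ᵥ u) := by
  rw [gramian_form_eq A hA]
  linarith [gramian_form_nonneg A hA (Aᵀ *ᵥ u)]

/-- Young's inequality for a positive semidefinite form: expand its value at `θ a - b`. -/
theorem gramian_form_add_le {d : ℕ} (A : Matrix (Fin d) (Fin d) ℝ)
    (hA : spectralRadius ℂ (A.map (algebraMap ℝ ℂ)) < 1) (θ : ℝ) (hθ : 0 < θ) (a b : Fin d → ℝ) :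
    (a + b) ⬝ᵥ (gramian A *ᵥ (a + b)) ≤
      (1 + θ) * (a ⬝ᵥ (gramian A *ᵥ a)) + (1 + 1 / θ) * (b ⬝ᵥ (gramian A *ᵥ b)) := by
  have hsym : b ⬝ᵥ (gramian A *ᵥ a) = a ⬝ᵥ (gramian A *ᵥ b) := by
    rw [dotProduct_mulVec, ← mulVec_transpose, gramian_transpose A, dotProduct_comm]
  have h := gramian_form_nonneg A hA (θ • a - b)
  simp only [mulVec_sub, mulVec_smul, dotProduct_sub, sub_dotProduct, dotProduct_smul,
    smul_dotProduct, smul_eq_mul, hsym] at h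
  simp only [mulVec_add, dotProduct_add, add_dotProduct, hsym]
  have h2 : 2 * (a ⬝ᵥ (gramian A *ᵥ b)) ≤
      θ * (a ⬝ᵥ (gramian A *ᵥ a)) + 1 / θ * (b ⬝ᵥ (gramian A *ᵥ b)) := by
    have : 0 ≤ (1 / θ) * (θ * (θ * (a ⬝ᵥ (gramian A *ᵥ a)) - a ⬝ᵥ (gramian A *ᵥ b)) -
        (θ * (a ⬝ᵥ (gramian A *ᵥ b)) - b ⬝ᵥ (gramian A *ᵥ b))) := by
      refine mul_nonneg (by positivity) ?_
      linarith
    have e : (1 / θ) * (θ * (θ * (a ⬝ᵥ (gramian A *ᵥ a)) - a ⬝ᵥ (gramian A *ᵥ b)) -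
        (θ * (a ⬝ᵥ (gramian A *ᵥ b)) - b ⬝ᵥ (gramian A *ᵥ b))) =
        θ * (a ⬝ᵥ (gramian A *ᵥ a)) - 2 * (a ⬝ᵥ (gramian A *ᵥ b)) +
        1 / θ * (b ⬝ᵥ (gramian A *ᵥ b)) := by field_simp; ring
    linarith
  linarith

theorem form_le_opNorm {d : ℕ} (N : Matrix (Fin d) (Fin d) ℝ) (u : Fin d → ℝ) :
    u ⬝ᵥ (N *ᵥ u) ≤ opNorm N * (u ⬝ᵥ u) := by
  let x : EuclideanSpace ℝ (Fin d) := WithLp.toLp 2 u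
  have h1 : inner ℝ x (Matrix.toEuclideanCLM (n := Fin d) (𝕜 := ℝ) N x) = u ⬝ᵥ (N *ᵥ u) := by
    rw [inner_toEuclideanCLM]
  have h2 : ‖x‖ ^ 2 = u ⬝ᵥ u := by
    rw [EuclideanSpace.norm_sq_eq]
    simp [x, dotProduct, sq]
  calc u ⬝ᵥ (N *ᵥ u) = _ := h1.symm
    _ ≤ ‖x‖ * ‖Matrix.toEuclideanCLM (n := Fin d) (𝕜 := ℝ) N x‖ := real_inner_le_norm _ _
    _ ≤ ‖x‖ * (opNorm N * ‖x‖) := by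
        gcongr
        exact ContinuousLinearMap.le_opNorm _ _
    _ = _ := by rw [← h2]; ring

theorem one_le_opNorm_gramian {d : ℕ} (hd : 1 ≤ d) (A : Matrix (Fin d) (Fin d) ℝ)
    (hA : spectralRadius ℂ (A.map (algebraMap ℝ ℂ)) < 1) : 1 ≤ opNorm (gramian A) := by
  let e : Fin d → ℝ := Pi.single ⟨0, hd⟩ 1
  have h := (self_le_gramian_form A hA e).trans (form_le_opNorm (gramian A) e)
  have h1 : e ⬝ᵥ e = 1 := by simp [e]
  rwa [h1, mul_one] at h

/-- A small perturbation of rank `k` at most doubles the stationary covariance. -/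
theorem gramian_perturbation {d k : ℕ} (hd : 1 ≤ d) (A : Matrix (Fin d) (Fin d) ℝ)
    (hA : spectralRadius ℂ (A.map (algebraMap ℝ ℂ)) < 1) (X Y : Matrix (Fin d) (Fin k) ℝ)
    (hX : Xᵀ * X = 1) (hY : Yᵀ * Y = 1) (s : ℝ) (hs0 : 0 ≤ s)
    (hs : s ≤ 1 / (4 * opNorm (gramian A) ^ 3)) (u : Fin d → ℝ) :
    2 * (((A + s • (X * Yᵀ))ᵀ *ᵥ u) ⬝ᵥ (gramian A *ᵥ ((A + s • (X * Yᵀ))ᵀ *ᵥ u))) + u ⬝ᵥ u ≤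
      2 * (u ⬝ᵥ (gramian A *ᵥ u)) := by
  set g := opNorm (gramian A)
  -- As `g ≥ 1`, the cubic smallness condition is stronger than `s g ≤ 1/4`, the only consequence of
  -- it used below.
  have hg : 1 ≤ g := one_le_opNorm_gramian hd A hA
  have hg0 : 0 < g := by linarith
  have hsg : s * g ≤ 1 / 4 := by
    calc s * g ≤ 1 / (4 * g ^ 3) * g := by gcongr
      _ = 1 / 4 * (1 / g ^ 2) := by field_simp
      _ ≤ 1 / 4 * 1 := by
          gcongr
          rw [div_le_one (by positivity)]
          exact one_le_pow₀ hg
      _ = 1 / 4 := by ring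
  have hN : 0 ≤ u ⬝ᵥ u := Finset.sum_nonneg fun _ _ => mul_self_nonneg _
  have hT : (A + s • (X * Yᵀ))ᵀ *ᵥ u = Aᵀ *ᵥ u + (s • (Y * Xᵀ)) *ᵥ u := by
    rw [transpose_add, transpose_smul, transpose_mul, transpose_transpose, add_mulVec]
  -- Bessel's inequality for the orthonormal columns of `X`, together with the isometry `Y`.
  have hΔ : ((s • (Y * Xᵀ)) *ᵥ u) ⬝ᵥ ((s • (Y * Xᵀ)) *ᵥ u) ≤ s ^ 2 * (u ⬝ᵥ u) := by
    rw [dotProduct_self_smul_mul_transpose Y X hY]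
    refine mul_le_mul_of_nonneg_left ?_ (sq_nonneg s)
    have e1 : ∑ j, (Xᵀ j ⬝ᵥ u) ^ 2 = (Xᵀ *ᵥ u) ⬝ᵥ (Xᵀ *ᵥ u) :=
      Finset.sum_congr rfl fun j _ => sq _
    have e2 : u ⬝ᵥ (X *ᵥ (Xᵀ *ᵥ u)) = (Xᵀ *ᵥ u) ⬝ᵥ (Xᵀ *ᵥ u) := by
      rw [dotProduct_mulVec, ← mulVec_transpose]
    have e3 : (X *ᵥ (Xᵀ *ᵥ u)) ⬝ᵥ (X *ᵥ (Xᵀ *ᵥ u)) = (Xᵀ *ᵥ u) ⬝ᵥ (Xᵀ *ᵥ u) := by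
      rw [dotProduct_mulVec, vecMul_mulVec, ← dotProduct_mulVec, hX, one_mulVec]
    have h : 0 ≤ (u - X *ᵥ (Xᵀ *ᵥ u)) ⬝ᵥ (u - X *ᵥ (Xᵀ *ᵥ u)) :=
      Finset.sum_nonneg fun _ _ => mul_self_nonneg _
    rw [dotProduct_sub, sub_dotProduct, sub_dotProduct, dotProduct_comm (X *ᵥ (Xᵀ *ᵥ u)) u, e2, e3] at h
    rw [e1]
    linarith
  -- With `θ = 1/(4g)` the loss on the main term is `θ a ≤ N/4 - N/(4g)`, as `a + N ≤ g N`. The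
  -- perturbation costs at most `N/4 + N/(4g)`. Together they cost `N/2`, which doubled is exactly
  -- what the Lyapunov equation leaves.
  have h1 := gramian_form_add_le A hA (1 / (4 * g)) (by positivity) (Aᵀ *ᵥ u) ((s • (Y * Xᵀ)) *ᵥ u)
  have h2 := gramian_form_eq A hA u
  have h3 := form_le_opNorm (gramian A) u
  have h4 : ((s • (Y * Xᵀ)) *ᵥ u) ⬝ᵥ (gramian A *ᵥ ((s • (Y * Xᵀ)) *ᵥ u)) ≤ g * (s ^ 2 * (u ⬝ᵥ u)) :=
    (form_le_opNorm _ _).trans (mul_le_mul_of_nonneg_left hΔ hg0.le)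
  rw [hT]
  set N := u ⬝ᵥ u
  set a := (Aᵀ *ᵥ u) ⬝ᵥ (gramian A *ᵥ (Aᵀ *ᵥ u))
  set b := ((s • (Y * Xᵀ)) *ᵥ u) ⬝ᵥ (gramian A *ᵥ ((s • (Y * Xᵀ)) *ᵥ u))
  have h5 : (1 + 1 / (1 / (4 * g))) * b ≤ (1 / 4 + 1 / (4 * g)) * N := by
    have h6 : (1 + 1 / (1 / (4 * g))) = 1 + 4 * g := by field_simp
    have h7 : s ^ 2 * g ^ 2 ≤ 1 / 16 := by
      rw [← mul_pow]
      calc (s * g) ^ 2 ≤ (1 / 4) ^ 2 := by gcongr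
        _ = 1 / 16 := by norm_num
    rw [h6]
    calc (1 + 4 * g) * b ≤ (1 + 4 * g) * (g * (s ^ 2 * N)) := by gcongr
      _ = (s ^ 2 * g ^ 2) * (4 + 1 / g) * N := by field_simp; ring
      _ ≤ 1 / 16 * (4 + 1 / g) * N := by gcongr
      _ ≤ (1 / 4 + 1 / (4 * g)) * N := by
          gcongr
          have : 0 < 1 / g := by positivity
          have e : 1 / (4 * g) = 1 / 4 * (1 / g) := by field_simp
          rw [e]
          linarith
  have h8 : 1 / (4 * g) * (N + a) ≤ N / 4 := by
    rw [← h2]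
    calc 1 / (4 * g) * (u ⬝ᵥ (gramian A *ᵥ u)) ≤ 1 / (4 * g) * (g * N) := by gcongr
      _ = N / 4 := by field_simp
  rw [h2]
  linarith

/-! ## Linear system identification -/

/-- The states of the system started at `x`. -/
def stateFrom {d n : ℕ} (A : Matrix (Fin d) (Fin d) ℝ) (x : Fin d → ℝ) (η : Fin n → Fin d → ℝ) :
    ℕ → Fin d → ℝ
  | 0 => x
  | t + 1 => A *ᵥ stateFrom A x η t + (if h : t < n then η ⟨t, h⟩ else 0)

theorem stateFrom_zero_eq_state {d n : ℕ} (A : Matrix (Fin d) (Fin d) ℝ) (η : Fin n → Fin d → ℝ)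
    (t : ℕ) : stateFrom A 0 η t = state A η t := by
  induction t with
  | zero => rfl
  | succ t ih => rw [stateFrom, state, ih]

theorem stateFrom_cons {d n : ℕ} (A : Matrix (Fin d) (Fin d) ℝ) (x a : Fin d → ℝ)
    (η : Fin n → Fin d → ℝ) (t : ℕ) :
    stateFrom A x (Fin.cons a η : Fin (n + 1) → Fin d → ℝ) (t + 1) =
      stateFrom A (A *ᵥ x + a) η t := by
  induction t with
  | zero =>
    simp only [stateFrom, Nat.zero_lt_succ, dite_true]
    rfl
  | succ t ih =>
    rw [stateFrom, ih, stateFrom]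
    congr 1
    by_cases h : t < n
    · rw [dif_pos h, dif_pos (Nat.succ_lt_succ h)]
      rfl
    · rw [dif_neg h, dif_neg (by omega)]

theorem measurable_stateFrom {d n : ℕ} (A : Matrix (Fin d) (Fin d) ℝ) (x : Fin d → ℝ) (t : ℕ) :
    Measurable fun η : Fin n → Fin d → ℝ => stateFrom A x η t := by
  induction t with
  | zero => exact measurable_const
  | succ t ih =>
    have h1 : Measurable fun x : Fin d → ℝ => A *ᵥ x := by unfold mulVec dotProduct; fun_prop
    refine (h1.comp ih).add ?_
    split_ifs
    · exact measurable_pi_apply _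
    · exact measurable_const

/-- The log-likelihood ratio along a trajectory. -/
def pathLogRatio {d n : ℕ} (σ : ℝ) (Δ B : Matrix (Fin d) (Fin d) ℝ) (x : Fin d → ℝ)
    (η : Fin n → Fin d → ℝ) : ℝ :=
  ∑ t : Fin n, (2 * (η t ⬝ᵥ (Δ *ᵥ stateFrom B x η t)) +
    (Δ *ᵥ stateFrom B x η t) ⬝ᵥ (Δ *ᵥ stateFrom B x η t)) / (2 * σ ^ 2)

/-- The noise shifted by the change of the drift. -/
def shiftNoise {d n : ℕ} (Δ B : Matrix (Fin d) (Fin d) ℝ) (x : Fin d → ℝ)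
    (η : Fin n → Fin d → ℝ) : Fin n → Fin d → ℝ :=
  fun t => η t + Δ *ᵥ stateFrom B x η t

theorem measurable_pathLogRatio {d n : ℕ} (σ : ℝ) (Δ B : Matrix (Fin d) (Fin d) ℝ)
    (x : Fin d → ℝ) : Measurable fun η : Fin n → Fin d → ℝ => pathLogRatio σ Δ B x η := by
  have h := measurable_stateFrom (n := n) B x
  unfold pathLogRatio dotProduct mulVec dotProduct
  fun_prop

theorem measurable_shiftNoise {d n : ℕ} (Δ B : Matrix (Fin d) (Fin d) ℝ)
    (x : Fin d → ℝ) : Measurable fun η : Fin n → Fin d → ℝ => shiftNoise Δ B x η := by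
  have h := measurable_stateFrom (n := n) B x
  unfold shiftNoise mulVec dotProduct
  fun_prop

theorem pathLogRatio_cons {d n : ℕ} (σ : ℝ) (Δ B : Matrix (Fin d) (Fin d) ℝ) (x a : Fin d → ℝ)
    (η : Fin n → Fin d → ℝ) :
    pathLogRatio σ Δ B x (Fin.cons a η : Fin (n + 1) → Fin d → ℝ) =
      (2 * (a ⬝ᵥ (Δ *ᵥ x)) + (Δ *ᵥ x) ⬝ᵥ (Δ *ᵥ x)) / (2 * σ ^ 2) +
        pathLogRatio σ Δ B (B *ᵥ x + a) η := by
  unfold pathLogRatio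
  rw [Fin.sum_univ_succ]
  simp only [Fin.cons_zero, Fin.cons_succ, Fin.val_zero, Fin.val_succ, stateFrom_cons]
  rfl

theorem shiftNoise_cons {d n : ℕ} (Δ B : Matrix (Fin d) (Fin d) ℝ) (x a : Fin d → ℝ)
    (η : Fin n → Fin d → ℝ) :
    shiftNoise Δ B x (Fin.cons a η : Fin (n + 1) → Fin d → ℝ) =
      Fin.cons (a + Δ *ᵥ x) (shiftNoise Δ B (B *ᵥ x + a) η) := by
  funext t
  cases t using Fin.cases with
  | zero => rfl
  | succ t => simp only [shiftNoise, Fin.cons_succ, Fin.val_succ, stateFrom_cons]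

theorem lintegral_pi_succ {X : Type*} [MeasurableSpace X] (μ : Measure X) [IsProbabilityMeasure μ]
    (n : ℕ) (F : (Fin (n + 1) → X) → ENNReal) (hF : Measurable F) :
    ∫⁻ η, F η ∂(Measure.pi fun _ : Fin (n + 1) => μ) =
      ∫⁻ a, ∫⁻ η, F (Fin.cons a η) ∂(Measure.pi fun _ : Fin n => μ) ∂μ := by
  have h := (measurePreserving_piFinSuccAbove (fun _ : Fin (n + 1) => μ) 0).symm
  rw [← h.lintegral_comp hF, lintegral_prod]
  · simp [MeasurableEquiv.piFinSuccAbove_symm_apply, Fin.insertNthEquiv]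
  · exact (hF.comp h.measurable).aemeasurable

theorem measurable_cons {X : Type*} [MeasurableSpace X] (n : ℕ) :
    Measurable fun p : X × (Fin n → X) => (Fin.cons p.1 p.2 : Fin (n + 1) → X) := by
  refine measurable_pi_lambda _ fun t => ?_
  cases t using Fin.cases with
  | zero => exact measurable_fst
  | succ t => exact (measurable_pi_apply t).comp measurable_snd

/-- A discrete Girsanov formula. -/
theorem lintegral_shiftNoise {d : ℕ} (σ : ℝ) (hσ : 0 < σ) (Δ B : Matrix (Fin d) (Fin d) ℝ) (n : ℕ)
    (x : Fin d → ℝ) (G : (Fin n → Fin d → ℝ) → ENNReal) (hG : Measurable G) :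
    ∫⁻ η, G η ∂(Measure.pi fun _ : Fin n => noise d σ) =
      ∫⁻ η, G (shiftNoise Δ B x η) * ENNReal.ofReal (Real.exp (-pathLogRatio σ Δ B x η))
        ∂(Measure.pi fun _ : Fin n => noise d σ) := by
  induction n generalizing x with
  | zero =>
    refine lintegral_congr fun η => ?_
    rw [Subsingleton.elim (shiftNoise Δ B x η) η]
    simp [pathLogRatio]
  | succ n ih =>
    have hc := measurable_cons (X := Fin d → ℝ) n
    have hm1 := measurable_shiftNoise (n := n + 1) Δ B x
    have hm2 := measurable_pathLogRatio (n := n + 1) σ Δ B x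
    rw [lintegral_pi_succ _ n G hG, lintegral_pi_succ _ n _ (by fun_prop)]
    have hmH : Measurable fun a : Fin d → ℝ =>
        ∫⁻ η, G (Fin.cons a η) ∂(Measure.pi fun _ : Fin n => noise d σ) :=
      Measurable.lintegral_prod_right' (ν := Measure.pi fun _ : Fin n => noise d σ)
        (f := fun p : (Fin d → ℝ) × (Fin n → Fin d → ℝ) => G (Fin.cons p.1 p.2)) (hG.comp hc)
    -- The shift of each noise depends on earlier noises only. The first one is translated by the
    -- known vector `Δ x`, and the induction hypothesis applies to the remaining ones from the new
    -- starting point `B x + a`; hence the arbitrary initial state.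
    rw [lintegral_noise_shift d σ hσ (Δ *ᵥ x) _ hmH]
    refine lintegral_congr fun a => ?_
    have hGa : Measurable fun η : Fin n → Fin d → ℝ =>
        G (Fin.cons (a + Δ *ᵥ x) η : Fin (n + 1) → Fin d → ℝ) :=
      hG.comp (hc.comp (measurable_const.prodMk measurable_id))
    rw [ih (B *ᵥ x + a) _ hGa, ← lintegral_mul_const']
    · refine lintegral_congr fun η => ?_
      rw [shiftNoise_cons, pathLogRatio_cons, neg_add, Real.exp_add,
        ENNReal.ofReal_mul (Real.exp_pos _).le]
      ring
    · exact ENNReal.ofReal_ne_top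

/-- The shift supplies the missing drift `Δ x_t` at every step. Past time `n` there is no noise to
shift, whence the restriction on `t`. -/
theorem state_shiftNoise {d n : ℕ} (A Δ : Matrix (Fin d) (Fin d) ℝ) (η : Fin n → Fin d → ℝ) (t : ℕ)
    (ht : t ≤ n) : state A (shiftNoise Δ (A + Δ) 0 η) t = state (A + Δ) η t := by
  induction t with
  | zero => rfl
  | succ t ih =>
    rw [state, state, ih (by omega), dif_pos (by omega), dif_pos (by omega), shiftNoise,
      stateFrom_zero_eq_state, add_mulVec]
    abel

/-! ### Second moments of the noise and of the states -/

section moments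

variable {d n : ℕ}

theorem memLp_pi_noise (σ : ℝ) (t : Fin n) (i : Fin d) :
    MemLp (fun η : Fin n → Fin d → ℝ => η t i) 2 (Measure.pi fun _ : Fin n => noise d σ) :=
  (memLp_noise d σ i).comp_measurePreserving
    (measurePreserving_eval (fun _ : Fin n => noise d σ) t)

theorem integral_pi_noise (σ : ℝ) (t : Fin n) (i : Fin d) :
    ∫ η, η t i ∂(Measure.pi fun _ : Fin n => noise d σ) = 0 := by
  rw [← integral_noise d σ i]
  exact integral_comp_eval (μ := fun _ : Fin n => noise d σ) (i := t) (f := fun a => a i)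
    (measurable_pi_apply i).aestronglyMeasurable

theorem integral_mul_pi_noise (σ : ℝ) (t : Fin n) (i j : Fin d) :
    ∫ η, η t i * η t j ∂(Measure.pi fun _ : Fin n => noise d σ) = if i = j then σ ^ 2 else 0 := by
  rw [← integral_mul_noise d σ i j]
  exact integral_comp_eval (μ := fun _ : Fin n => noise d σ) (i := t) (f := fun a => a i * a j)
    ((measurable_pi_apply i).mul (measurable_pi_apply j)).aestronglyMeasurable

theorem integral_mul_pi_noise_of_ne (σ : ℝ) {t s : Fin n} (h : t ≠ s) (i j : Fin d) :
    ∫ η, η t i * η s j ∂(Measure.pi fun _ : Fin n => noise d σ) = 0 := by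
  have hind : IndepFun (fun η : Fin n → Fin d → ℝ => η t) (fun η => η s)
      (Measure.pi fun _ : Fin n => noise d σ) :=
    (iIndepFun_pi (μ := fun _ : Fin n => noise d σ) (X := fun _ x => x)
      fun _ => aemeasurable_id).indepFun h
  have hind' : IndepFun (fun η : Fin n → Fin d → ℝ => η t i) (fun η => η s j)
      (Measure.pi fun _ : Fin n => noise d σ) :=
    hind.comp (measurable_pi_apply i) (measurable_pi_apply j)
  rw [hind'.integral_fun_mul_eq_mul_integral (memLp_pi_noise σ t i).1 (memLp_pi_noise σ s j).1,
    integral_pi_noise, zero_mul]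

theorem memLp_state (σ : ℝ) (B : Matrix (Fin d) (Fin d) ℝ) (t : ℕ) (i : Fin d) :
    MemLp (fun η : Fin n → Fin d → ℝ => state B η t i) 2
      (Measure.pi fun _ : Fin n => noise d σ) := by
  induction t generalizing i with
  | zero => exact MemLp.zero
  | succ t ih =>
    refine MemLp.add (f := fun η : Fin n → Fin d → ℝ => B i ⬝ᵥ state B η t)
      (memLp_dotProduct ih (B i)) ?_
    by_cases h : t < n
    · simp only [dif_pos h]
      exact memLp_pi_noise σ ⟨t, h⟩ i
    · simp only [dif_neg h]
      exact MemLp.zero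

/-- A state involves earlier noises only. The linear recursion reduces the claim to the
uncorrelatedness of noises at distinct times. -/
theorem integral_noise_mul_state (σ : ℝ) (B : Matrix (Fin d) (Fin d) ℝ) (t : ℕ) (s : Fin n)
    (hts : t ≤ s) (i j : Fin d) :
    ∫ η, η s i * state B η t j ∂(Measure.pi fun _ : Fin n => noise d σ) = 0 := by
  induction t generalizing j with
  | zero => simp [state]
  | succ t ih =>
    have ht : t < n := by omega
    have e : ∀ η : Fin n → Fin d → ℝ, η s i * state B η (t + 1) j =
        ∑ l, B j l * (η s i * state B η t l) + η s i * η ⟨t, ht⟩ j := fun η => by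
      simp only [state, dif_pos ht, Pi.add_apply, mulVec, dotProduct, mul_add, Finset.mul_sum]
      congr 1
      exact Finset.sum_congr rfl fun l _ => by ring
    have hint : ∀ l, Integrable (fun η : Fin n → Fin d → ℝ => B j l * (η s i * state B η t l))
        (Measure.pi fun _ : Fin n => noise d σ) := fun l =>
      ((memLp_pi_noise σ s i).integrable_mul (memLp_state σ B t l)).const_mul _
    have hint2 : Integrable (fun η : Fin n → Fin d → ℝ => η s i * η ⟨t, ht⟩ j)
        (Measure.pi fun _ : Fin n => noise d σ) :=
      (memLp_pi_noise σ s i).integrable_mul (memLp_pi_noise σ ⟨t, ht⟩ j)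
    simp only [e]
    rw [integral_add (integrable_finsetSum _ fun l _ => hint l) hint2,
      integral_finsetSum _ fun l _ => hint l,
      integral_mul_pi_noise_of_ne σ (by rw [Ne, Fin.ext_iff]; simp; omega), add_zero]
    refine Finset.sum_eq_zero fun l _ => ?_
    rw [integral_const_mul, ih (by omega), mul_zero]

/-- A Lyapunov function for `Bᵀ` bounds the covariances of the states. -/
theorem integral_dotProduct_state_sq_le (σ : ℝ) (B : Matrix (Fin d) (Fin d) ℝ)
    (q : (Fin d → ℝ) → ℝ) (hq0 : ∀ u, 0 ≤ q u) (hq : ∀ u, q (Bᵀ *ᵥ u) + u ⬝ᵥ u ≤ q u) (t : ℕ)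
    (ht : t ≤ n) (u : Fin d → ℝ) :
    ∫ η, (u ⬝ᵥ state B η t) ^ 2 ∂(Measure.pi fun _ : Fin n => noise d σ) ≤ σ ^ 2 * q u := by
  induction t generalizing u with
  | zero =>
    simp only [state, dotProduct_zero, ne_eq, OfNat.ofNat_ne_zero, not_false_eq_true, zero_pow,
      integral_zero]
    exact mul_nonneg (sq_nonneg σ) (hq0 u)
  | succ t ih =>
    have htn : t < n := by omega
    set π := Measure.pi fun _ : Fin n => noise d σ
    have hx := fun i => memLp_state (n := n) σ B t i
    have hη := fun i => memLp_pi_noise (d := d) σ (⟨t, htn⟩ : Fin n) i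
    -- The middle term has mean zero and the last has mean `σ² |u|²`, so the Lyapunov inequality for
    -- `q` closes the induction.
    have e : ∀ η : Fin n → Fin d → ℝ, (u ⬝ᵥ state B η (t + 1)) ^ 2 =
        ((Bᵀ *ᵥ u) ⬝ᵥ state B η t) ^ 2 + 2 * ((u ⬝ᵥ η ⟨t, htn⟩) * ((Bᵀ *ᵥ u) ⬝ᵥ state B η t)) +
          (u ⬝ᵥ η ⟨t, htn⟩) * (u ⬝ᵥ η ⟨t, htn⟩) := fun η => by
      rw [state, dif_pos htn, dotProduct_add, dotProduct_mulVec, ← mulVec_transpose]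
      ring
    have i1 : Integrable (fun η : Fin n → Fin d → ℝ => ((Bᵀ *ᵥ u) ⬝ᵥ state B η t) ^ 2) π :=
      (memLp_dotProduct hx (Bᵀ *ᵥ u)).integrable_sq
    have i2 : Integrable (fun η : Fin n → Fin d → ℝ =>
        (u ⬝ᵥ η ⟨t, htn⟩) * ((Bᵀ *ᵥ u) ⬝ᵥ state B η t)) π :=
      (memLp_dotProduct hη u).integrable_mul (memLp_dotProduct hx (Bᵀ *ᵥ u))
    have i3 : Integrable (fun η : Fin n → Fin d → ℝ => (u ⬝ᵥ η ⟨t, htn⟩) * (u ⬝ᵥ η ⟨t, htn⟩)) π :=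
      (memLp_dotProduct hη u).integrable_mul (memLp_dotProduct hη u)
    have z2 : ∫ η, (u ⬝ᵥ η ⟨t, htn⟩) * ((Bᵀ *ᵥ u) ⬝ᵥ state B η t) ∂π = 0 := by
      rw [integral_dotProduct_mul hη hx]
      refine Finset.sum_eq_zero fun i _ => Finset.sum_eq_zero fun j _ => ?_
      rw [integral_noise_mul_state σ B t ⟨t, htn⟩ le_rfl, mul_zero]
    have z3 : ∫ η, (u ⬝ᵥ η ⟨t, htn⟩) * (u ⬝ᵥ η ⟨t, htn⟩) ∂π = σ ^ 2 * (u ⬝ᵥ u) := by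
      rw [integral_dotProduct_mul hη hη, dotProduct, Finset.mul_sum]
      refine Finset.sum_congr rfl fun i _ => ?_
      simp only [integral_mul_pi_noise, mul_ite, mul_zero, Finset.sum_ite_eq, Finset.mem_univ,
        if_true]
      ring
    simp only [e]
    have i12 : Integrable (fun η : Fin n → Fin d → ℝ => ((Bᵀ *ᵥ u) ⬝ᵥ state B η t) ^ 2 +
        2 * ((u ⬝ᵥ η ⟨t, htn⟩) * ((Bᵀ *ᵥ u) ⬝ᵥ state B η t))) π := i1.add (i2.const_mul 2)
    rw [integral_add i12 i3, integral_add i1 (i2.const_mul 2), integral_const_mul, z2, z3]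
    have h1 := ih (by omega) (Bᵀ *ᵥ u)
    have h2 := mul_le_mul_of_nonneg_left (hq u) (sq_nonneg σ)
    linarith

end moments

theorem measurable_sysId_map {d : ℕ} (n : ℕ) (A : Matrix (Fin d) (Fin d) ℝ) :
    Measurable fun (η : Fin n → Fin d → ℝ) (i : Fin n) => (state A η i.val, state A η (i.val + 1)) := by
  have h : ∀ t, Measurable fun η : Fin n → Fin d → ℝ => state A η t := fun t => by
    simp only [← stateFrom_zero_eq_state]
    exact measurable_stateFrom A 0 t
  exact measurable_pi_lambda _ fun i => (h _).prodMk (h _)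

theorem isProbabilityMeasure_sysIdLaw {d : ℕ} (σ : ℝ) (n : ℕ) (A : Matrix (Fin d) (Fin d) ℝ) :
    IsProbabilityMeasure (sysIdLaw σ n A) :=
  Measure.isProbabilityMeasure_map (measurable_sysId_map n A).aemeasurable

theorem infoBound_sysIdLaw {d : ℕ} (hd : 1 ≤ d) (σ : ℝ) (hσ : 0 < σ)
    (A : Matrix (Fin d) (Fin d) ℝ) (hA : spectralRadius ℂ (A.map (algebraMap ℝ ℂ)) < 1)
    (n k : ℕ) (s : ℝ) (hs0 : 0 ≤ s) (hs : s ≤ 1 / (4 * opNorm (gramian A) ^ 3)) :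
    InfoBound (sysIdLaw σ) A (σ ^ 2 • gramian A) σ n k s := by
  intro X Y hX hY U hU τ hτ
  set Δ := s • (X * Yᵀ) with hΔ
  set π := Measure.pi fun _ : Fin n => noise d σ with hπ
  have hlog := fun t : Fin n => integral_logRatio (μ := π) (x := fun η => state (A + Δ) η t)
    (η := fun η => η t) (fun i => memLp_state σ (A + Δ) t i) (fun i => memLp_pi_noise σ t i)
    (fun i j => integral_noise_mul_state σ (A + Δ) t t le_rfl i j) X Y hX s σ
  -- The form `2 Γ_∞(A)` bounds the covariances of the perturbed system without any reference to the
  -- Gramian of `A + Δ`. Its factor `2` cancels the `1/2` of the Gaussian information.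
  have hcov : ∀ (t : Fin n) (u : Fin d → ℝ), ∫ η, (u ⬝ᵥ state (A + Δ) η t) ^ 2 ∂π ≤
      σ ^ 2 * (2 * (u ⬝ᵥ (gramian A *ᵥ u))) := fun t u =>
    integral_dotProduct_state_sq_le σ (A + Δ) (fun u => 2 * (u ⬝ᵥ (gramian A *ᵥ u)))
      (fun u => by have := gramian_form_nonneg A hA u; positivity)
      (fun u => gramian_perturbation hd A hA X Y hX hY s hs0 hs u) t t.isLt.le u
  have hLR : pathLogRatio (n := n) σ Δ (A + Δ) 0 = fun η => ∑ t : Fin n,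
      (2 * (η t ⬝ᵥ (Δ *ᵥ state (A + Δ) η t)) +
        (Δ *ᵥ state (A + Δ) η t) ⬝ᵥ (Δ *ᵥ state (A + Δ) η t)) / (2 * σ ^ 2) := by
    funext η
    simp only [pathLogRatio, stateFrom_zero_eq_state]
  have hint : Integrable (pathLogRatio (n := n) σ Δ (A + Δ) 0) π := by
    rw [hLR]
    exact integrable_finsetSum _ fun t _ => (hlog t).1
  have hDV := mul_real_sub_integral_le_log_two π _ _ (measurable_sysId_map n A)
    (measurable_sysId_map n (A + Δ)) (pathLogRatio σ Δ (A + Δ) 0) hint (fun G hG => by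
      refine (lintegral_shiftNoise σ hσ Δ (A + Δ) n 0 _
        (hG.comp (measurable_sysId_map n A))).trans (lintegral_congr fun η => ?_)
      congr 1
      refine congrArg G (funext fun i => ?_)
      change (state A (shiftNoise Δ (A + Δ) 0 η) i, state A (shiftNoise Δ (A + Δ) 0 η) (i + 1)) = _
      rw [state_shiftNoise A Δ η i i.isLt.le, state_shiftNoise A Δ η (i + 1) i.isLt]) U hU τ hτ
  change τ * (sysIdLaw σ n (A + Δ)).real U - _ ≤ _ at hDV
  have hbound : ∫ η, pathLogRatio (n := n) σ Δ (A + Δ) 0 η ∂π ≤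
      n * s ^ 2 * (Yᵀ * (σ ^ 2 • gramian A) * Y).trace / σ ^ 2 := by
    rw [hLR, integral_finsetSum _ fun t _ => (hlog t).1]
    calc _ = ∑ t : Fin n, s ^ 2 * (∑ j, ∫ η, (Yᵀ j ⬝ᵥ state (A + Δ) η t) ^ 2 ∂π) / (2 * σ ^ 2) :=
          Finset.sum_congr rfl fun t _ => (hlog t).2
      _ ≤ ∑ t : Fin n, s ^ 2 * (∑ j, σ ^ 2 * (2 * (Yᵀ j ⬝ᵥ (gramian A *ᵥ Yᵀ j)))) / (2 * σ ^ 2) := by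
          gcongr with t _ j _
          exact hcov t _
      _ = _ := by
          rw [trace_transpose_mul_mul]
          simp only [smul_mulVec, dotProduct_smul, smul_eq_mul, ← Finset.mul_sum, Finset.sum_const,
            Finset.card_univ, Fintype.card_fin, nsmul_eq_mul]
          field_simp
  linarith

end RankAdaptive

end

theorem mainTheorem2 :
    (∃ (C : ℝ) (P : (k d : ℕ) → Finset (Matrix (Fin d) (Fin k) ℝ)),
      1 < C ∧ IsStiefelPacking C P) ∧
    ∀ (C : ℝ) (P : (k d : ℕ) → Finset (Matrix (Fin d) (Fin k) ℝ)),
      1 < C → IsStiefelPacking C P →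
      -- multivariate regression
      (∀ (dx dy r : ℕ), 1 ≤ r → 2 * r ≤ dx → 2 * r ≤ dy →
        ∀ (σ ε δ : ℝ), 0 < σ → 0 < ε → 0 < δ → δ ≤ 1 / 2 →
        ∀ (ν : Measure (Fin dx → ℝ)), IsProbabilityMeasure ν →
          (∀ i, MemLp (fun x : Fin dx → ℝ => x i) 2 ν) → (secondMoment ν).PosDef →
        ∀ (A : Matrix (Fin dy) (Fin dx) ℝ), A.rank ≤ r →
        ∀ (S : SVD A) (E : EigenDecomp (secondMoment ν)) (κ : ℕ → ℕ),
          (κ = optimalRank S E σ δ r ∨ ∀ n, 1 ≤ n → κ n ∈ Set.Icc 1 r) →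
        ∀ (alg : Algorithm dx dy), (∀ n i j, Measurable fun z => alg n z i j) →
          IsStableAlg C P (regressionLaw ν σ) S E κ ε δ alg →
          ∃ n₀, IsLeast {n | 1 ≤ n ∧
              gammaFn S E σ δ κ n ≤ 32 * C ^ 2 / Real.log 2 * ε ^ 2} n₀ ∧
            n₀ ≤ sampleComplexity C P (regressionLaw ν σ) S E κ ε δ alg) ∧
      -- linear system identification
      (∀ (d r : ℕ), 1 ≤ r → 2 * r ≤ d →
        ∀ (σ ε δ : ℝ), 0 < σ → 0 < ε → 0 < δ → δ ≤ 1 / 2 →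
        ∀ (A : Matrix (Fin d) (Fin d) ℝ), A.rank ≤ r →
          spectralRadius ℂ (A.map (algebraMap ℝ ℂ)) < 1 →
        ∀ (S : SVD A) (E : EigenDecomp (σ ^ 2 • gramian A)) (κ : ℕ → ℕ),
          (κ = optimalRank S E σ δ r ∨ ∀ n, 1 ≤ n → κ n ∈ Set.Icc 1 r) →
        ∀ (alg : Algorithm d d), (∀ n i j, Measurable fun z => alg n z i j) →
          IsStableAlg C P (sysIdLaw σ) S E κ ε δ alg →
          2 * C * ε / √(κ (sampleComplexity C P (sysIdLaw σ) S E κ ε δ alg) : ℝ)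
            ≤ 1 / (4 * opNorm (gramian A) ^ 3) →
          ∃ n₀, IsLeast {n | 1 ≤ n ∧
              gammaFn S E σ δ κ n ≤ 32 * C ^ 2 / Real.log 2 * ε ^ 2} n₀ ∧
            n₀ ≤ sampleComplexity C P (sysIdLaw σ) S E κ ε δ alg) := by
  refine ⟨exists_isStiefelPacking, fun C P hC hP => ⟨?_, ?_⟩⟩
  · intro dx dy r hr hrx hry σ ε δ hσ hε hδ hδ2 ν hν hν2 hM A _ S E κ hκ alg halg hst
    have hM' : ∀ v, v ≠ 0 → 0 < v ⬝ᵥ (secondMoment ν *ᵥ v) := fun v hv => by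
      simpa using hM.dotProduct_mulVec_pos hv
    exact exists_isLeast_le_sampleComplexity C P hC hP _
      (fun n A => isProbabilityMeasure_regressionLaw ν σ n A) S E hM' r hr hrx hry κ σ ε δ hσ hε hδ
      hδ2 hκ alg halg hst fun n _ => infoBound_regressionLaw ν hν2 σ hσ A n _ _
  · intro d r hr hrd σ ε δ hσ hε hδ hδ2 A _ hA S E κ hκ alg halg hst hsmall
    -- The term `t = 0` of the Gramian is the identity, so the stationary covariance is positive
    -- definite.
    have hM' : ∀ v, v ≠ 0 → 0 < v ⬝ᵥ ((σ ^ 2 • gramian A) *ᵥ v) := fun v hv => by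
      rw [smul_mulVec, dotProduct_smul, smul_eq_mul]
      have h1 : 0 < v ⬝ᵥ v := by simpa using dotProduct_star_self_pos_iff.2 hv
      have h2 := self_le_gramian_form A hA v
      have : 0 < v ⬝ᵥ (gramian A *ᵥ v) := by linarith
      positivity
    refine exists_isLeast_le_sampleComplexity C P hC hP _
      (fun n A => isProbabilityMeasure_sysIdLaw σ n A) S E hM' r hr hrd hrd κ σ ε δ hσ hε hδ
      hδ2 hκ alg halg hst fun n hn => ?_
    subst hn
    exact infoBound_sysIdLaw (by omega) σ hσ A hA _ _ _ (by positivity) hsmall
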